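/- Consider the lattice graph $\mathbb{Z}^2$, where $n(v)$ denotes the set of the four neighbours of $v$. A \emph{state} is a function $\phi:\mathbb{Z}^2\to\mathbb{Z}_{\ge 0}$; it is \emph{stable} if $\phi<4$ everywhere. A \emph{toppling} at $v$, legal if $\phi(v)\ge 4$, decreases $\phi(v)$ by $4$ and increases $\phi$ by $1$ at each vertex of $n(v)$. A \emph{relaxation} of $\phi$ is a finite or infinite sequence of legal topplings starting from $\phi$; a state is \emph{relaxable} if it has a relaxation whose states stabilize at every vertex and whose pointwise limit is stable, and this limit is the \emph{result} of the relaxation. A \emph{territory} of a stable state $\phi$ is a connected component, with at least two vertices, of the subgraph induced on $\{\phi=3\}$. Let $v$ be a vertex of a territory $\mathcal{T}$ of $\phi$ such that $\phi+\delta_v$ is relaxable. Add a grain at $v$, topple $v$, topple each unstable vertex of $n(v)\cap\mathcal{T}$, and then remove one grain from $v$; the result of the relaxation of the state so obtained is $W_v\phi$, the result of sending a wave from $v$. We write $W_{\mathcal{T}}\phi=\psi$ if, for every $v\in\mathcal{T}$, the state $\phi+\delta_v$ is relaxable and $W_v\phi=\psi$. For $\alpha\in\mathbb{P}\mathbb{Q}^1$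 let $(p,q)$ be a primitive integer vector with $[p:q]=\alpha$, let $L_\alpha\subset\mathbb{R}^2$ be the line through the origin spanned by $(p,q)$, put $F(x,y)=qx-py$, and let $(p',q')$ be an integer vector with $F(p',q')=1$. \textbf{Theorem.} For every $\alpha\in\mathbb{P}\mathbb{Q}^1$ there is a sand soliton in the direction $\alpha$, that is, a stable state $\phi$ on $\mathbb{Z}^2$ such that, for each choice of $(p,q)$ and $(p',q')$ as above, \begin{itemize} \item $\phi(-v)=\phi(v)$ and $\phi(v+(p,q))=\phi(v)$ for all $v\in\mathbb{Z}^2$; \item the set $\{v:\phi(v)<3\}$ is contained in a tubular neighbourhood of $L_\alpha$ of finite radius, and the subgraph induced on $\{v:\phi(v)=3\}$ has exactly two infinite connected components, $\mathcal{T}$ and $-\mathcal{T}$, with $F>0$ on $\mathcal{T}$ and $F<0$ on $-\mathcal{T}$; \item $W_{\mathcal{T}}\phi(v)=\phi(v-(p',q'))$ and $W_{-\mathcal{T}}\phi(v)=\phi(v+(p',q'))$ for all $v\in\mathbb{Z}^2$. \end{itemize} -/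

import Mathlib

namespace Sandpile

open scoped Pointwise

/-- The four neighbours `n(v)` of a vertex of the lattice `ℤ²`. -/
def nbrs (v : ℤ × ℤ) : Finset (ℤ × ℤ) :=
  {(v.1 + 1, v.2), (v.1 - 1, v.2), (v.1, v.2 + 1), (v.1, v.2 - 1)}

/-- The lattice graph on `ℤ²`. -/
def lattice : SimpleGraph (ℤ × ℤ) where
  Adj v w := w ∈ nbrs v
  symm := ⟨by
    rintro ⟨a, b⟩ ⟨c, d⟩ h
    simp only [nbrs, Finset.mem_insert, Finset.mem_singleton, Prod.mk.injEq] at h ⊢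
    omega⟩
  loopless := ⟨by
    rintro ⟨a, b⟩ h
    simp only [nbrs, Finset.mem_insert, Finset.mem_singleton, Prod.mk.injEq] at h
    omega⟩

/-- A state: a non-negative integer-valued function on `ℤ²`. -/
def IsState (φ : ℤ × ℤ → ℤ) : Prop := ∀ v, 0 ≤ φ v

/-- A stable state. -/
def IsStable (φ : ℤ × ℤ → ℤ) : Prop := IsState φ ∧ ∀ v, φ v < 4

/-- The toppling `T_v`. -/
def topple (v : ℤ × ℤ) (φ : ℤ × ℤ → ℤ) : ℤ × ℤ → ℤ := fun w =>
  if w = v then φ w - 4 else if v ∈ nbrs w then φ w + 1 else φ w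

/-- A relaxation of `φ`: a finite or infinite sequence of legal topplings starting at `φ`.
Idle steps are allowed, so that a finite sequence is one that is eventually idle. -/
def IsRelaxation (φ : ℤ × ℤ → ℤ) (ψ : ℕ → ℤ × ℤ → ℤ) : Prop :=
  ψ 0 = φ ∧ ∀ i, ψ (i + 1) = ψ i ∨ ∃ v, 4 ≤ ψ i v ∧ ψ (i + 1) = topple v (ψ i)

/-- `φ'` is the result of a stabilizing (locally finite) relaxation of the state `φ`. -/
def RelaxesTo (φ φ' : ℤ × ℤ → ℤ) : Prop :=
  IsState φ ∧ IsStable φ' ∧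
    ∃ ψ, IsRelaxation φ ψ ∧ ∀ v, ∃ N, ∀ i, N ≤ i → ψ i v = φ' v

/-- A state that has a stabilizing relaxation. -/
def Relaxable (φ : ℤ × ℤ → ℤ) : Prop := ∃ φ', RelaxesTo φ φ'

/-- A territory of `φ`: a connected component, with at least two elements, of `{φ = 3}`. -/
structure IsTerritory (φ : ℤ × ℤ → ℤ) (T : Set (ℤ × ℤ)) : Prop where
  connected : (lattice.induce T).Connected
  eq_three : ∀ v ∈ T, φ v = 3
  lt_three : ∀ w, w ∉ T → (∃ v ∈ nbrs w, v ∈ T) → φ w < 3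
  nontrivial : T.Nontrivial

open Classical in
/-- The state from which a wave at `v ∈ T` is relaxed: add a grain at `v`, topple `v`, topple every
unstable vertex of `n(v) ∩ T`, and remove a grain from `v`. -/
noncomputable def waveStart (φ : ℤ × ℤ → ℤ) (T : Set (ℤ × ℤ)) (v : ℤ × ℤ) : ℤ × ℤ → ℤ :=
  let φ₁ := topple v (φ + Pi.single v 1)
  let A := (nbrs v).filter fun u => u ∈ T ∧ 4 ≤ φ₁ u
  let φ₂ := φ₁ + ∑ u ∈ A, (topple u φ₁ - φ₁)
  φ₂ - Pi.single v 1

/-- `W_T φ` is defined and equals `φ'`: for every `v` in the territory `T` the state `φ + δ_v` is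
relaxable and the wave sent from `v` results in `φ'`. -/
def WaveEq (φ : ℤ × ℤ → ℤ) (T : Set (ℤ × ℤ)) (φ' : ℤ × ℤ → ℤ) : Prop :=
  IsTerritory φ T ∧ ∀ v ∈ T, Relaxable (φ + Pi.single v 1) ∧ RelaxesTo (waveStart φ T v) φ'

/-- The linear form `F_{p,q}(x,y) = q x - p y`. -/
def form (p q : ℤ) (v : ℤ × ℤ) : ℤ := q * v.1 - p * v.2

/-- A lattice vertex as a point of the Euclidean plane. -/
noncomputable def toPlane (v : ℤ × ℤ) : EuclideanSpace ℝ (Fin 2) := !₂[(v.1 : ℝ), (v.2 : ℝ)]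

/-- The line through the origin spanned by `(p,q)`. -/
noncomputable def line (p q : ℤ) : Set (EuclideanSpace ℝ (Fin 2)) :=
  (Submodule.span ℝ {toPlane (p, q)} : Submodule ℝ (EuclideanSpace ℝ (Fin 2)))

/-- `(p,q)` is a primitive integer vector on the rational line `α`. -/
def IsPrimitiveVector (α : Projectivization ℚ (ℚ × ℚ)) (p q : ℤ) : Prop :=
  IsCoprime p q ∧ ((p : ℚ), (q : ℚ)) ∈ α.submodule

/-- Every rational direction contains a primitive vector. -/
theorem exists_isPrimitiveVector (α : Projectivization ℚ (ℚ × ℚ)) :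
    ∃ p q, IsPrimitiveVector α p q := by
  obtain ⟨⟨a, b⟩, hv, rfl⟩ : ∃ v, ∃ hv : v ≠ 0, Projectivization.mk ℚ v hv = α :=
    ⟨α.rep, α.rep_nonzero, α.mk_rep⟩
  have hne : a.num * b.den ≠ 0 ∨ b.num * a.den ≠ 0 := by
    by_contra h
    push Not at h
    apply hv
    have ha : a.num = 0 := by simpa using h.1
    have hb : b.num = 0 := by simpa using h.2
    simp [Rat.num_eq_zero.1 ha, Rat.num_eq_zero.1 hb]
  have hg : Int.gcd (a.num * b.den) (b.num * a.den) ≠ 0 := by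
    rw [Ne, Int.gcd_eq_zero_iff]
    tauto
  obtain ⟨x', hx⟩ := Int.gcd_dvd_left (a.num * b.den) (b.num * a.den)
  obtain ⟨y', hy⟩ := Int.gcd_dvd_right (a.num * b.den) (b.num * a.den)
  refine ⟨x', y', ?_, ?_⟩
  · have h1 := Int.isCoprime_iff_gcd_eq_one.2
      (Int.gcd_div_gcd_div_gcd (Nat.pos_of_ne_zero hg))
    have e1 : a.num * b.den / (Int.gcd (a.num * b.den) (b.num * a.den) : ℤ) = x' :=
      Int.ediv_eq_of_eq_mul_right (by exact_mod_cast hg) hx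
    have e2 : b.num * a.den / (Int.gcd (a.num * b.den) (b.num * a.den) : ℤ) = y' :=
      Int.ediv_eq_of_eq_mul_right (by exact_mod_cast hg) hy
    rwa [e1, e2] at h1
  · rw [Projectivization.submodule_mk, Submodule.mem_span_singleton]
    generalize Int.gcd (a.num * b.den) (b.num * a.den) = g at hx hy hg
    refine ⟨(a.den : ℚ) * b.den / g, ?_⟩
    have hg' : (g : ℚ) ≠ 0 := by exact_mod_cast hg
    have hx' : (a.num : ℚ) * b.den = g * x' := by exact_mod_cast hx
    have hy' : (b.num : ℚ) * a.den = g * y' := by exact_mod_cast hy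
    have ha := Rat.mul_den_eq_num a
    have hb := Rat.mul_den_eq_num b
    simp only [Prod.smul_mk, smul_eq_mul, Prod.mk.injEq]
    constructor
    · field_simp
      rw [← ha] at hx'
      linear_combination hx'
    · field_simp
      rw [← hb] at hy'
      linear_combination hy'

/-- `φ` is a sand soliton in the direction `α`. The conditions are required for each of the two
primitive vectors `(p,q)` of `α` and for every choice of `(p',q')` with `F_{p,q}(p',q') = 1`. -/
structure IsSandSoliton (α : Projectivization ℚ (ℚ × ℚ)) (φ : ℤ × ℤ → ℤ) : Prop where
  stable : IsStable φ
  symmetric : ∀ v, φ (-v) = φ v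
  periodic : ∀ p q, IsPrimitiveVector α p q → ∀ v, φ (v + (p, q)) = φ v
  strip : ∀ p q, IsPrimitiveVector α p q →
    ∃ R : ℝ, ∀ v, φ v < 3 → toPlane v ∈ Metric.thickening R (line p q)
  /-- There are exactly two infinite components `T`, `-T` of `{φ = 3}`, separated by the sign of
  `F`, and the waves sent from them translate `φ` by `(p',q')` and `-(p',q')`. -/
  wave : ∀ p q, IsPrimitiveVector α p q → ∃ T : Set (ℤ × ℤ),
    IsTerritory φ T ∧ T.Infinite ∧ IsTerritory φ (-T) ∧
    (∀ T', IsTerritory φ T' → T'.Infinite → T' = T ∨ T' = -T) ∧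
    (∀ v ∈ T, 0 < form p q v) ∧ (∀ v ∈ -T, form p q v < 0) ∧
    ∀ p' q', form p q (p', q') = 1 →
      WaveEq φ T (fun v => φ (v - (p', q'))) ∧ WaveEq φ (-T) (fun v => φ (v + (p', q')))

end Sandpile

/-!
The soliton is `3 + Δ(θ ∘ F)`, where `θ` is the least superharmonic function of the level `F` that
agrees with `min 0 k` for all but finitely many levels `k`. Such a least function exists because
superharmonic competitors with slopes between zero and one have Laplacians of total mass at most
`p ^ 2 + q ^ 2`; hence within a bounded distance there is a long interval free of mass, on which the
competitor is linear.

A toppling function adds its Laplacian to the state, so `θ(F - 1) + 1 - θ(F)` carries the state to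
its translate by one level. This function is `1` on the upper territory and stabilizes the wave; by
the least action principle the wave topples no more than that, and by the minimality of `θ`,
applied to the minima over the levels, no less.

Suppose that a territory is infinite but occupies only finitely many levels. It then contains a path
between two vertices of the same level, whose translates by multiples of `(p, q)` join up to cut the
plane; so, by counting crossings, its levels separate `-∞` from `+∞` under steps `±p`, `±q`. As `θ`
is harmonic at these levels, a slope zero or one that occurs there spreads over all of them by the
minimum principle, and `θ k = k` below the territory or `θ k = 0` above it. The territory then
continues past its extreme level.
-/

namespace Sandpile

open scoped Pointwise

/-! ### Paths and the graph Laplacian -/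

section PathIn

variable {α β : Type*} {r : α → α → Prop} {s : β → β → Prop} {X Y : Set α} {x y z : α}

/-- Reachability of `y` from `x` along steps of the relation `r` that end in `X`. The starting point
`x` need not lie in `X`, so that a path may leave from the outside. -/
def PathIn (r : α → α → Prop) (X : Set α) : α → α → Prop :=
  Relation.ReflTransGen fun x y => r x y ∧ y ∈ X

namespace PathIn

theorem refl (x : α) : PathIn r X x x := Relation.ReflTransGen.refl

theorem single (h : r x y) (hy : y ∈ X) : PathIn r X x y :=
  Relation.ReflTransGen.single ⟨h, hy⟩

theorem trans (h : PathIn r X x y) (h' : PathIn r X y z) : PathIn r X x z :=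
  Relation.ReflTransGen.trans h h'

theorem mono (h : PathIn r X x y) (hXY : X ⊆ Y) : PathIn r Y x y :=
  Relation.ReflTransGen.mono (fun _ _ hab => ⟨hab.1, hXY hab.2⟩) _ _ h

theorem mem_of_closed (h : PathIn r X x y) (hx : x ∈ Y)
    (hY : ∀ a ∈ Y, ∀ b ∈ X, r a b → b ∈ Y) : y ∈ Y := by
  induction h with
  | refl => exact hx
  | tail _ hab ih => exact hY _ ih _ hab.2 hab.1

theorem mem (h : PathIn r X x y) (hx : x ∈ X) : y ∈ X :=
  h.mem_of_closed hx fun _ _ _ hb _ => hb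

theorem restrict (h : PathIn r X x y) (hx : x ∈ Y) (hY : ∀ a ∈ Y, ∀ b ∈ X, r a b → b ∈ Y) :
    PathIn r Y x y := by
  induction h with
  | refl => exact refl x
  | tail h hab ih => exact ih.trans (single hab.1 (hY _ (mem_of_closed h hx hY) _ hab.2 hab.1))

theorem map {f : α → β} {Z : Set β} (h : PathIn r X x y) (hf : ∀ a b, r a b → s (f a) (f b))
    (hX : Set.MapsTo f X Z) : PathIn s Z (f x) (f y) :=
  Relation.ReflTransGen.lift f (fun _ _ hab => ⟨hf _ _ hab.1, hX hab.2⟩) _ _ h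

theorem symm (hr : ∀ a b, r a b → r b a) (h : PathIn r X x y) (hx : x ∈ X) : PathIn r X y x := by
  induction h with
  | refl => exact refl x
  | tail h hab ih => exact (single (hr _ _ hab.1) (mem h hx)).trans ih

theorem exists_finite (h : PathIn r X x y) : ∃ F : Set α, F.Finite ∧ PathIn r F x y := by
  induction h with
  | refl => exact ⟨∅, Set.finite_empty, refl x⟩
  | @tail b c _ hbc ih =>
    obtain ⟨F, hF, hxb⟩ := ih
    exact ⟨insert c F, hF.insert c,
      (hxb.mono (Set.subset_insert c F)).trans (single hbc.1 (Set.mem_insert c F))⟩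

end PathIn

end PathIn

section Laplacian

variable {G H : Type*} [AddCommGroup G] [AddCommGroup H] {a b : G} {a' b' : H} {u v : G → ℤ}
  {x y : G}

/-- The graph Laplacian of the Cayley graph of `G` with steps `±a`, `±b`. For `G = ℤ²` and the
standard basis it describes topplings; functions of `form p q` lead to `G = ℤ` with steps
`±p`, `±q`. -/
def lap (a b : G) (u : G → ℤ) (x : G) : ℤ :=
  u (x + a) + u (x - a) + u (x + b) + u (x - b) - 4 * u x

/-- Adjacency in the Cayley graph of `G` with steps `±a`, `±b`. -/
def Step (a b x y : G) : Prop := y = x + a ∨ y = x - a ∨ y = x + b ∨ y = x - b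

/-- A function whose value at each point is at least the mean over the four neighbours. -/
def Superharmonic (a b : G) (u : G → ℤ) : Prop := ∀ x, lap a b u x ≤ 0

theorem Step.symm (h : Step a b x y) : Step a b y x := by
  rcases h with rfl | rfl | rfl | rfl <;> simp [Step]

theorem Step.map {f : G → H} (ha : ∀ x, f (x + a) = f x + a') (hb : ∀ x, f (x + b) = f x + b')
    (h : Step a b x y) : Step a' b' (f x) (f y) := by
  have ha' (x : G) : f (x - a) = f x - a' := by rw [eq_sub_iff_add_eq, ← ha, sub_add_cancel]
  have hb' (x : G) : f (x - b) = f x - b' := by rw [eq_sub_iff_add_eq, ← hb, sub_add_cancel]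
  rcases h with rfl | rfl | rfl | rfl <;> simp [Step, ha, hb, ha', hb']

theorem Step.neg (h : Step a b x y) : Step a b (-x) (-y) := by
  rcases h with rfl | rfl | rfl | rfl
  exacts [.inr (.inl (by abel)), .inl (by abel), .inr (.inr (.inr (by abel))),
    .inr (.inr (.inl (by abel)))]

theorem Step.add_right (c : G) (h : Step a b x y) : Step a b (x + c) (y + c) :=
  h.map (f := (· + c)) (fun x => add_right_comm x a c) (fun x => add_right_comm x b c)

theorem lap_comp {f : G → H} (ha : ∀ x, f (x + a) = f x + a') (hb : ∀ x, f (x + b) = f x + b')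
    (u : H → ℤ) (x : G) : lap a b (fun x => u (f x)) x = lap a' b' u (f x) := by
  have ha' (x : G) : f (x - a) = f x - a' := by rw [eq_sub_iff_add_eq, ← ha, sub_add_cancel]
  have hb' (x : G) : f (x - b) = f x - b' := by rw [eq_sub_iff_add_eq, ← hb, sub_add_cancel]
  simp only [lap, ha, hb, ha', hb']

theorem lap_add (a b : G) (u v : G → ℤ) (x : G) :
    lap a b (fun x => u x + v x) x = lap a b u x + lap a b v x := by
  simp only [lap]
  ring

theorem lap_sub (a b : G) (u v : G → ℤ) (x : G) :
    lap a b (fun x => u x - v x) x = lap a b u x - lap a b v x := by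
  simp only [lap]
  ring

theorem lap_const (a b : G) (c : ℤ) (x : G) : lap a b (fun _ => c) x = 0 := by
  simp only [lap]
  ring

theorem lap_int_id (a b x : ℤ) : lap a b (fun k => k) x = 0 := by
  simp only [lap]
  ring

theorem lap_neg_left (a b : G) (u : G → ℤ) (x : G) : lap (-a) b u x = lap a b u x := by
  simp only [lap, ← sub_eq_add_neg, sub_neg_eq_add]
  ring

theorem lap_neg_right (a b : G) (u : G → ℤ) (x : G) : lap a (-b) u x = lap a b u x := by
  simp only [lap, ← sub_eq_add_neg, sub_neg_eq_add]
  ring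

theorem lap_comp_neg (a b : G) (u : G → ℤ) (x : G) :
    lap a b (fun x => u (-x)) x = lap a b u (-x) := by
  rw [lap_comp (f := fun x => -x) (neg_add · a) (neg_add · b), lap_neg_left, lap_neg_right]

theorem lap_comp_add_right (a b : G) (u : G → ℤ) (c x : G) :
    lap a b (fun x => u (x + c)) x = lap a b u (x + c) :=
  lap_comp (f := (· + c)) (fun x => add_right_comm x a c) (fun x => add_right_comm x b c) u x

theorem lap_indicator [DecidableEq G] (a b : G) (A : Finset G) (x : G) :
    lap a b (Set.indicator A 1) x = ∑ u ∈ A, lap a b (Pi.single u 1) x := by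
  simp only [lap, Finset.sum_sub_distrib, Finset.sum_add_distrib, ← Finset.mul_sum,
    Pi.single_apply, Finset.sum_ite_eq, Set.indicator_apply, Finset.mem_coe, Pi.one_apply]

theorem lap_le_lap_of_step (hx : u x = v x) (h : ∀ y, Step a b x y → u y ≤ v y) :
    lap a b u x ≤ lap a b v x := by
  have h₁ := h (x + a) (.inl rfl)
  have h₂ := h (x - a) (.inr (.inl rfl))
  have h₃ := h (x + b) (.inr (.inr (.inl rfl)))
  have h₄ := h (x - b) (.inr (.inr (.inr rfl)))
  simp only [lap, hx]
  linarith

theorem lap_eq_zero_of_step (h : ∀ y, Step a b x y → u y = u x) : lap a b u x = 0 := by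
  rw [lap, h _ (.inl rfl), h _ (.inr (.inl rfl)), h _ (.inr (.inr (.inl rfl))),
    h _ (.inr (.inr (.inr rfl)))]
  ring

theorem le_lap_add (hu : ∀ z, 0 ≤ u z) (h : Step a b x y) : u y ≤ lap a b u x + 4 * u x := by
  have := hu (x + a)
  have := hu (x - a)
  have := hu (x + b)
  have := hu (x - b)
  simp only [lap]
  rcases h with rfl | rfl | rfl | rfl <;> omega

theorem eq_of_step_of_lap_nonpos (hu : lap a b u x ≤ 0) (h : ∀ y, Step a b x y → u x ≤ u y)
    (hxy : Step a b x y) : u y = u x := by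
  have h₁ := h (x + a) (.inl rfl)
  have h₂ := h (x - a) (.inr (.inl rfl))
  have h₃ := h (x + b) (.inr (.inr (.inl rfl)))
  have h₄ := h (x - b) (.inr (.inr (.inr rfl)))
  simp only [lap] at hu
  rcases hxy with rfl | rfl | rfl | rfl <;> linarith

theorem superharmonic_of_touching
    (h : ∀ x, ∃ v, lap a b v x ≤ 0 ∧ u x = v x ∧ ∀ y, Step a b x y → u y ≤ v y) :
    Superharmonic a b u := fun x =>
  let ⟨_, hv, hx, hy⟩ := h x
  (lap_le_lap_of_step hx hy).trans hv

namespace Superharmonic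

theorem inf (hu : Superharmonic a b u) (hv : Superharmonic a b v) :
    Superharmonic a b fun x => min (u x) (v x) :=
  superharmonic_of_touching fun x => (min_choice (u x) (v x)).elim
    (fun h => ⟨u, hu x, h, fun _ _ => min_le_left _ _⟩)
    (fun h => ⟨v, hv x, h, fun _ _ => min_le_right _ _⟩)

theorem piecewise {C : Set G} [DecidablePred (· ∈ C)] (hu : Superharmonic a b u)
    (hv : Superharmonic a b v) (h : ∀ x ∈ C, ∀ y ∉ C, Step a b x y → v y ≤ u y ∧ u x ≤ v x) :
    Superharmonic a b (C.piecewise u v) := by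
  refine superharmonic_of_touching fun x => ?_
  by_cases hx : x ∈ C
  · refine ⟨u, hu x, Set.piecewise_eq_of_mem C u v hx, fun y hxy => ?_⟩
    by_cases hy : y ∈ C
    · exact (Set.piecewise_eq_of_mem C u v hy).le
    · exact (Set.piecewise_eq_of_notMem C u v hy).trans_le (h x hx y hy hxy).1
  · refine ⟨v, hv x, Set.piecewise_eq_of_notMem C u v hx, fun y hxy => ?_⟩
    by_cases hy : y ∈ C
    · exact (Set.piecewise_eq_of_mem C u v hy).trans_le (h y hy x hx hxy.symm).2
    · exact (Set.piecewise_eq_of_notMem C u v hy).le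

end Superharmonic

theorem pathIn_univ_of_closure_eq_top (hab : AddSubgroup.closure {a, b} = ⊤) (x y : G) :
    PathIn (Step a b) Set.univ x y := by
  have key : ∀ z ∈ AddSubgroup.closure {a, b}, ∀ x, PathIn (Step a b) Set.univ x (x + z) := by
    intro z hz
    induction hz using AddSubgroup.closure_induction with
    | mem z hz =>
      rcases hz with rfl | rfl
      · exact fun x => .single (.inl rfl) trivial
      · exact fun x => .single (.inr (.inr (.inl rfl))) trivial
    | zero => exact fun x => by simpa using PathIn.refl x
    | add y z _ _ hy hz => exact fun x => by simpa [add_assoc] using (hy x).trans (hz (x + y))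
    | neg z _ hz =>
      exact fun x => by simpa using (hz (x + -z)).symm (fun _ _ => Step.symm) trivial
  simpa using key (y - x) (hab ▸ AddSubgroup.mem_top _) x

theorem PathIn.eq_of_lap_nonpos {X : Set G} (h : PathIn (Step a b) X x y) (hx : x ∈ X)
    (hu : ∀ z ∈ X, lap a b u z ≤ 0) (hmin : ∀ z, u x ≤ u z) : u y = u x :=
  (h.mem_of_closed (Y := {z ∈ X | u z = u x}) ⟨hx, rfl⟩ fun z hz _ hw hzw => ⟨hw,
    (eq_of_step_of_lap_nonpos (hu z hz.1) (fun w _ => hz.2.trans_le (hmin w)) hzw).trans hz.2⟩).2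

theorem Superharmonic.eq_of_le (hu : Superharmonic a b u)
    (hab : AddSubgroup.closure {a, b} = ⊤) (hx : ∀ y, u x ≤ u y) (y : G) : u y = u x :=
  (pathIn_univ_of_closure_eq_top hab x y).eq_of_lap_nonpos trivial (fun z _ => hu z) hx

end Laplacian

theorem exists_pointwise_least {α : Type*} {S : Set (α → ℤ)} (hS : S.Nonempty)
    (hb : ∀ x, BddBelow ((fun u => u x) '' S)) :
    ∃ m : α → ℤ, (∀ u ∈ S, ∀ x, m x ≤ u x) ∧ ∀ x, ∃ u ∈ S, u x = m x :=
  ⟨fun x => sInf ((fun u => u x) '' S), fun u hu x => csInf_le (hb x) ⟨u, hu, rfl⟩,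
    fun x => by simpa using Int.csInf_mem (hS.image _) (hb x)⟩

/-! ### Step functions of the level -/

section Level

variable {p q : ℤ} {g : ℤ → ℤ}

theorem closure_pair_eq_top (h : IsCoprime p q) : AddSubgroup.closure {p, q} = ⊤ := by
  obtain ⟨x, y, hxy⟩ := h
  refine (AddSubgroup.eq_top_iff' _).2 fun k => AddSubgroup.mem_closure_pair.2 ⟨k * x, k * y, ?_⟩
  rw [smul_eq_mul, smul_eq_mul]
  linear_combination k * hxy

theorem exists_window (h : IsCoprime p q) :
    ∃ S : ℤ, 0 ≤ S ∧ ∀ k, PathIn (Step p q) (Set.Icc (k - S) (k + S)) k (k + 1) := by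
  obtain ⟨F, hF, hpath⟩ :=
    (pathIn_univ_of_closure_eq_top (closure_pair_eq_top h) 0 1).exists_finite
  obtain ⟨a, ha⟩ := hF.bddBelow
  obtain ⟨b, hb⟩ := hF.bddAbove
  refine ⟨|a| + |b|, by positivity, fun k => ?_⟩
  have hwindow : Set.MapsTo (k + ·) F (Set.Icc (k - (|a| + |b|)) (k + (|a| + |b|))) := by
    intro j hj
    have := ha hj
    have := hb hj
    have := neg_abs_le a
    have := le_abs_self b
    have := abs_nonneg a
    have := abs_nonneg b
    exact Set.mem_Icc.2 (by dsimp only; omega)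
  simpa using hpath.map (fun _ _ => Step.map (fun x => (add_assoc k x p).symm)
    (fun x => (add_assoc k x q).symm)) hwindow

theorem superharmonic_min_zero (p q : ℤ) : Superharmonic p q fun k => min 0 k :=
  Superharmonic.inf (fun k => (lap_const p q 0 k).le) fun k => (lap_int_id p q k).le

theorem lap_reflect (p q : ℤ) (g : ℤ → ℤ) (k : ℤ) :
    lap p q (fun k => g (-k) + k) k = lap p q g (-k) := by
  rw [lap_add, lap_int_id, add_zero, lap_comp_neg]

theorem lap_add_shift (p q : ℤ) (g : ℤ → ℤ) (n c k : ℤ) :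
    lap p q (fun k => g (k + n) + c) k = lap p q g (k + n) := by
  rw [lap_add, lap_const, add_zero, lap_comp_add_right]

/-- The competitors for the profile of a soliton that have slopes zero and one: superharmonic
functions of the level that agree with `min 0 k` far from the level zero. -/
structure IsStep (p q : ℤ) (g : ℤ → ℤ) : Prop where
  superharmonic : Superharmonic p q g
  eventually_eq : ∀ᶠ k in Filter.cofinite, g k = min 0 k
  monotone : Monotone g
  antitone_sub : Antitone fun k => g k - k

namespace IsStep

theorem reflect (hg : IsStep p q g) : IsStep p q (fun k => g (-k) + k) where
  superharmonic k := (lap_reflect p q g k).trans_le (hg.superharmonic _)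
  eventually_eq :=
    (neg_injective.tendsto_cofinite.eventually hg.eventually_eq).mono fun k hk => by omega
  monotone a b hab := by
    have := hg.antitone_sub (neg_le_neg hab)
    dsimp only at this ⊢
    omega
  antitone_sub a b hab := by simpa using hg.monotone (neg_le_neg hab)

theorem exists_eq_zero (hg : IsStep p q g) : ∃ R, ∀ k, R ≤ k → g k = 0 := by
  have hg := hg.eventually_eq
  rw [Int.cofinite_eq, Filter.eventually_sup] at hg
  exact Filter.eventually_atTop.1
    ((hg.2.and (Filter.eventually_ge_atTop 0)).mono fun k hk => hk.1.trans (min_eq_left hk.2))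

theorem exists_eq_self (hg : IsStep p q g) : ∃ R, ∀ k ≤ R, g k = k := by
  obtain ⟨R, hR⟩ := hg.reflect.exists_eq_zero
  refine ⟨-R, fun k hk => ?_⟩
  have := hR (-k) (by omega)
  rw [neg_neg] at this
  omega

theorem nonpos (hg : IsStep p q g) (k : ℤ) : g k ≤ 0 := by
  obtain ⟨R, hR⟩ := hg.exists_eq_zero
  exact (hg.monotone (le_max_left k R)).trans_eq (hR _ (le_max_right k R))

theorem le_self (hg : IsStep p q g) (k : ℤ) : g k ≤ k := by
  have := hg.reflect.nonpos (-k)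
  rw [neg_neg] at this
  omega

/-- The function that continues `g k - k` beyond `B` as a constant is superharmonic and attains its
minimum, so it is constant. -/
theorem eq_self_of_sub_eq (hg : IsStep p q g) (hpq : IsCoprime p q) {A B : ℤ}
    (hAB : A + 2 * (|p| + |q|) ≤ B) (h : g A - A = g B - B) : ∀ k ≤ B, g k = k := by
  let w : ℤ → ℤ := fun k => g (min k B) - min k B
  have hp := abs_le.1 (le_refl |p|)
  have hq := abs_le.1 (le_refl |q|)
  have w_left : ∀ k ≤ B, w k = g k - k := fun k hk => by simp only [w, min_eq_left hk]
  have w_right : ∀ k, A ≤ k → w k = w B := fun k hk => by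
    have h₁ := hg.antitone_sub (min_le_right k B)
    have h₂ := hg.antitone_sub (le_min hk (by omega : A ≤ B))
    dsimp only [w] at h₁ h₂ ⊢
    rw [min_self]
    omega
  have hw : Superharmonic p q w := superharmonic_of_touching fun x => by
    by_cases hx : x + (|p| + |q|) ≤ B
    · refine ⟨fun k => g k - k, ?_, w_left x (by omega), fun y hxy => (w_left y ?_).le⟩
      · rw [lap_sub, lap_int_id, sub_zero]
        exact hg.superharmonic x
      · rcases hxy with rfl | rfl | rfl | rfl <;> omega
    · refine ⟨fun _ => w B, (lap_const p q _ x).le, w_right x (by omega),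
        fun y hxy => (w_right y ?_).le⟩
      rcases hxy with rfl | rfl | rfl | rfl <;> omega
  have w_const := hw.eq_of_le (closure_pair_eq_top hpq) (x := B) fun k => by
    simpa only [w, min_self] using hg.antitone_sub (min_le_right k B)
  obtain ⟨R, hR⟩ := hg.exists_eq_self
  intro k hk
  have h₁ := w_left k hk
  have h₂ := w_left (min R B) (min_le_right R B)
  rw [w_const, hR _ (min_le_left R B)] at h₂
  rw [w_const] at h₁
  omega

theorem eq_zero_of_eq (hg : IsStep p q g) (hpq : IsCoprime p q) {A B : ℤ}
    (hAB : A + 2 * (|p| + |q|) ≤ B) (h : g A = g B) (k : ℤ) (hk : A ≤ k) : g k = 0 := by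
  have := hg.reflect.eq_self_of_sub_eq hpq (A := -B) (B := -A) (by omega) (by simp [h]) (-k)
    (by omega)
  simpa using this

end IsStep

/-! ### A uniform bound on the support of step functions -/

theorem sum_range_sub_shift_le {c : ℕ → ℤ} {r : ℕ} (h0 : ∀ k, 0 ≤ c k) (hr : ∀ k, c k ≤ r)
    (n : ℕ) : ∑ k ∈ Finset.range n, (c k - c (r + k)) ≤ r * r := by
  have hswap : ∑ k ∈ Finset.range r, c k + ∑ k ∈ Finset.range n, c (r + k)
      = ∑ k ∈ Finset.range n, c k + ∑ k ∈ Finset.range r, c (n + k) := by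
    rw [← Finset.sum_range_add, ← Finset.sum_range_add, add_comm]
  have h₁ : ∑ k ∈ Finset.range r, c k ≤ r * r := by
    simpa using Finset.sum_le_card_nsmul (Finset.range r) c r fun k _ => hr k
  have h₂ : 0 ≤ ∑ k ∈ Finset.range r, c (n + k) := Finset.sum_nonneg fun k _ => h0 _
  rw [Finset.sum_sub_distrib]
  linarith

theorem exists_block_eq_zero {μ : ℕ → ℤ} (hμ : ∀ k, 0 ≤ μ k) {N W : ℕ}
    (hN : ∑ k ∈ Finset.range (N * W), μ k < N) : ∃ i < N, ∀ j < W, μ (i * W + j) = 0 := by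
  have hblocks : ∑ k ∈ Finset.range (N * W), μ k
      = ∑ i ∈ Finset.range N, ∑ j ∈ Finset.range W, μ (i * W + j) := by
    clear hN
    induction N with
    | zero => simp
    | succ N ih => rw [Nat.succ_mul, Finset.sum_range_add, ih, Finset.sum_range_succ]
  obtain ⟨i, hi, hlt⟩ := Finset.exists_lt_of_sum_lt (g := fun _ => (1 : ℤ))
    (hblocks.symm.trans_lt (by simpa using hN))
  refine ⟨i, Finset.mem_range.1 hi, fun j hj => ?_⟩
  have hzero := (Finset.sum_eq_zero_iff_of_nonneg fun j _ => hμ (i * W + j)).1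
    (le_antisymm (Int.lt_add_one_iff.1 hlt) (Finset.sum_nonneg fun j _ => hμ (i * W + j)))
  exact hzero j (Finset.mem_range.2 hj)

namespace IsStep

theorem sum_second_difference_le (hg : IsStep p q g) (r : ℕ) (x : ℤ) (n : ℕ) :
    ∑ k ∈ Finset.range n, (2 * g (x + k) - g (x + k + r) - g (x + k - r)) ≤ r * r := by
  refine (Finset.sum_congr rfl fun k _ => ?_).trans_le
    (sum_range_sub_shift_le (c := fun k => g (x + k) - g (x + k - r)) (r := r)
      (fun k => ?_) (fun k => ?_) n)
  · have h₁ : x + ((r + k : ℕ) : ℤ) = x + k + r := by push_cast; ring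
    simp only [h₁, add_sub_cancel_right]
    ring
  · exact sub_nonneg.2 (hg.monotone (by omega))
  · have := hg.antitone_sub (show x + k - r ≤ x + k by omega)
    dsimp only at this
    omega

theorem sum_neg_lap_le (hg : IsStep p q g) (x : ℤ) (n : ℕ) :
    ∑ k ∈ Finset.range n, -lap p q g (x + k) ≤ p * p + q * q := by
  have hlap (k : ℤ) : lap p q g k = lap (p.natAbs : ℤ) q.natAbs g k := by
    rcases Int.natAbs_eq p with hp | hp <;> rcases Int.natAbs_eq q with hq | hq <;>
      conv_lhs => rw [hp, hq]
    all_goals simp only [lap_neg_left, lap_neg_right]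
  rw [← Int.natAbs_mul_self' p, ← Int.natAbs_mul_self' q]
  refine le_trans (le_of_eq ?_) (add_le_add (hg.sum_second_difference_le p.natAbs x n)
    (hg.sum_second_difference_le q.natAbs x n))
  rw [← Finset.sum_add_distrib]
  refine Finset.sum_congr rfl fun k _ => ?_
  rw [hlap, lap]
  ring

theorem slope_eq_zero_iff_succ (hg : IsStep p q g) {S k : ℤ} (hS : 0 ≤ S)
    (hpath : PathIn (Step p q) (Set.Icc (k - S) (k + S)) k (k + 1))
    (hlap : ∀ j, k - S ≤ j → j ≤ k + S + 1 → lap p q g j = 0) :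
    g (k + 1) - g k = 0 ↔ g (k + 1 + 1) - g (k + 1) = 0 := by
  let D : ℤ → ℤ := fun k => g (k + 1) - g k
  have D_nonneg (k : ℤ) : 0 ≤ D k := sub_nonneg.2 (hg.monotone (by omega))
  have D_lap : ∀ j ∈ Set.Icc (k - S) (k + S), lap p q D j ≤ 0 := fun j hj => by
    have hj := Set.mem_Icc.1 hj
    rw [lap_sub, lap_comp_add_right, hlap _ (by omega) (by omega), hlap _ (by omega) (by omega),
      sub_zero]
  have hk : k ∈ Set.Icc (k - S) (k + S) := Set.mem_Icc.2 (by omega)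
  exact ⟨fun h => (hpath.eq_of_lap_nonpos hk D_lap fun j => h.trans_le (D_nonneg j)).trans h,
    fun h => ((hpath.symm (fun _ _ => Step.symm) hk).eq_of_lap_nonpos (hpath.mem hk) D_lap
      fun j => h.trans_le (D_nonneg j)).trans h⟩

theorem eq_or_sub_eq_of_lap_eq_zero (hg : IsStep p q g) {S A B : ℤ} (hS : 0 ≤ S) (hAB : A ≤ B)
    (hpath : ∀ k, PathIn (Step p q) (Set.Icc (k - S) (k + S)) k (k + 1))
    (hlap : ∀ k, A - S ≤ k → k ≤ B + S → lap p q g k = 0) : g A = g B ∨ g A - A = g B - B := by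
  have hslope : ∀ k, A ≤ k → k < B → (g (k + 1) - g k = 0 ↔ g (A + 1) - g A = 0) := by
    intro k hk
    induction k, hk using Int.leInduction with
    | base => exact fun _ => Iff.rfl
    | succ k hk ih =>
      intro hkB
      exact (hg.slope_eq_zero_iff_succ hS (hpath k)
        fun j _ _ => hlap j (by omega) (by omega)).symm.trans (ih (by omega))
  have hle (k : ℤ) : g (k + 1) ≤ g k + 1 := by
    have := hg.antitone_sub (show k ≤ k + 1 by omega)
    dsimp only at this
    omega
  have hge (k : ℤ) : g k ≤ g (k + 1) := hg.monotone (by omega)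
  rcases eq_or_ne (g (A + 1) - g A) 0 with h | h
  · refine .inl (Int.leInduction (motive := fun k _ => k ≤ B → g A = g k) (fun _ => rfl)
      (fun k hk ih hkB => ?_) B hAB le_rfl)
    have := (hslope k hk (by omega)).2 h
    have := ih (by omega)
    omega
  · refine .inr (Int.leInduction (motive := fun k _ => k ≤ B → g A - A = g k - k) (fun _ => rfl)
      (fun k hk ih hkB => ?_) B hAB le_rfl)
    have := mt (hslope k hk (by omega)).1 h
    have := ih (by omega)
    have := hle k
    have := hge k
    omega

end IsStep

theorem exists_linear_window (hpq : IsCoprime p q) (L : ℕ) :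
    ∃ M : ℕ, ∀ g, IsStep p q g → ∀ x : ℤ, ∃ A, x ≤ A ∧ A + L ≤ x + M ∧
      (g A = g (A + L) ∨ g A - A = g (A + L) - (A + L)) := by
  obtain ⟨S, hS, hpath⟩ := exists_window hpq
  lift S to ℕ using hS
  obtain ⟨m, hm⟩ := Int.eq_ofNat_of_zero_le
    (add_nonneg (mul_self_nonneg p) (mul_self_nonneg q))
  refine ⟨(m + 1) * (2 * S + L + 1), fun g hg x => ?_⟩
  obtain ⟨i, hi, hfree⟩ := exists_block_eq_zero (μ := fun k => -lap p q g (x + k))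
    (fun k => neg_nonneg.2 (hg.superharmonic _)) (N := m + 1) (W := 2 * S + L + 1)
    ((hg.sum_neg_lap_le x _).trans_lt (by push_cast; omega))
  have hfit : i * (2 * S + L + 1) + (2 * S + L + 1) ≤ (m + 1) * (2 * S + L + 1) :=
    (Nat.succ_mul _ _).symm.trans_le (Nat.mul_le_mul_right _ hi)
  generalize i * (2 * S + L + 1) = t at *
  generalize (m + 1) * (2 * S + L + 1) = M at *
  refine ⟨x + t + S, by omega, by omega,
    hg.eq_or_sub_eq_of_lap_eq_zero (by positivity) (by omega) hpath fun k h₁ h₂ => ?_⟩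
  have := hfree (k - x - t).toNat (by omega)
  rwa [Nat.cast_add, Int.toNat_of_nonneg (by omega), add_sub_cancel, add_sub_cancel,
    neg_eq_zero] at this

theorem exists_support_bound (hpq : IsCoprime p q) :
    ∃ N : ℤ, ∀ g, IsStep p q g → ∀ k, N ≤ |k| → g k = min 0 k := by
  obtain ⟨M, hM⟩ := exists_linear_window hpq (2 * (p.natAbs + q.natAbs))
  have eq_zero : ∀ g, IsStep p q g → ∀ k, (M : ℤ) + 1 ≤ k → g k = 0 := by
    intro g hg k hk
    obtain ⟨A, hA, hAM, h⟩ := hM g hg 1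
    have hL : A + 2 * (|p| + |q|) ≤ A + (2 * (p.natAbs + q.natAbs) : ℕ) := by
      rw [Int.abs_eq_natAbs, Int.abs_eq_natAbs]
      push_cast
      rfl
    rcases h with h | h
    · exact hg.eq_zero_of_eq hpq hL h k (by omega)
    · have := hg.eq_self_of_sub_eq hpq hL h _ le_rfl
      have := hg.nonpos (A + (2 * (p.natAbs + q.natAbs) : ℕ))
      omega
  refine ⟨M + 1, fun g hg k hk => ?_⟩
  rcases le_abs.1 hk with hk | hk
  · rw [eq_zero g hg k hk]
    omega
  · have := eq_zero _ hg.reflect (-k) hk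
    rw [neg_neg] at this
    omega

/-! ### Existence of the profile -/

/-- The profile of a soliton: the least superharmonic function of the level that agrees with
`min 0 k` far from the level zero. -/
structure IsProfile (p q : ℤ) (θ : ℤ → ℤ) : Prop where
  superharmonic : Superharmonic p q θ
  eventually_eq : ∀ᶠ k in Filter.cofinite, θ k = min 0 k
  le : ∀ g : ℤ → ℤ, Superharmonic p q g → (∀ᶠ k in Filter.cofinite, min 0 k ≤ g k) →
    ∀ k, θ k ≤ g k

/-- Obstacles with slopes zero and one below `min 0 k`: the least superharmonic majorant of each of
them is a step function. -/
def obstacle (n k : ℤ) : ℤ := max (min k (-n)) (min (k - n) 0)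

theorem exists_obstacle_le {h : ℤ → ℤ} (hh : ∀ᶠ k in Filter.cofinite, min 0 k ≤ h k) :
    ∃ n, 0 ≤ n ∧ ∀ k, obstacle n k ≤ h k := by
  have hfin := Filter.eventually_cofinite.1 hh
  obtain ⟨b, hb⟩ := hfin.bddAbove
  obtain ⟨c, hc⟩ := (hfin.image h).bddBelow
  refine ⟨|b| + |c|, by positivity, fun k => ?_⟩
  have := le_abs_self b
  have := neg_abs_le c
  have := abs_nonneg b
  have := abs_nonneg c
  unfold obstacle
  by_cases hk : min 0 k ≤ h k
  · omega
  · have : k ≤ b := hb hk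
    have : c ≤ h k := hc ⟨k, hk, rfl⟩
    omega

theorem eventually_cofinite_of_le_abs {P : ℤ → Prop} {R : ℤ} (h : ∀ k, R ≤ |k| → P k) :
    ∀ᶠ k in Filter.cofinite, P k :=
  Filter.eventually_cofinite.2 <| (Set.finite_Ioo (-R) R).subset fun k hk =>
    abs_lt.1 (not_le.1 (mt (h k) hk))

theorem exists_isStep_le_of_obstacle_le (p q : ℤ) {n : ℤ} (hn : 0 ≤ n) :
    ∃ g, IsStep p q g ∧ ∀ h, Superharmonic p q h → (∀ k, obstacle n k ≤ h k) →
      ∀ k, g k ≤ h k := by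
  have min_zero_mem : (Superharmonic p q fun k => min 0 k) ∧ ∀ k, obstacle n k ≤ min 0 k :=
    ⟨superharmonic_min_zero p q, fun k => by unfold obstacle; omega⟩
  obtain ⟨g, hle, heq⟩ := exists_pointwise_least
    (S := {h : ℤ → ℤ | Superharmonic p q h ∧ ∀ k, obstacle n k ≤ h k}) ⟨_, min_zero_mem⟩
    fun k => ⟨obstacle n k, by rintro _ ⟨h, hh, rfl⟩; exact hh.2 k⟩
  have g_superharmonic : Superharmonic p q g := superharmonic_of_touching fun x =>
    let ⟨h, hh, hx⟩ := heq x
    ⟨h, hh.1 x, hx.symm, fun y _ => hle h hh y⟩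
  have obstacle_le (k : ℤ) : obstacle n k ≤ g k :=
    let ⟨_, hh, hk⟩ := heq k
    (hh.2 k).trans_eq hk
  have le_shift (m c : ℤ) (hmc : ∀ k, obstacle n k ≤ obstacle n (k + m) + c) (k : ℤ) :
      g k ≤ g (k + m) + c :=
    hle (fun k => g (k + m) + c) ⟨fun k => (lap_add_shift p q g m c k).trans_le
      (g_superharmonic _), fun k => (hmc k).trans (Int.add_le_add_right (obstacle_le _) c)⟩ k
  refine ⟨g, ⟨g_superharmonic, eventually_cofinite_of_le_abs (R := n) fun k hk => ?_,
    monotone_int_of_le_succ fun k => ?_, antitone_int_of_succ_le fun k => ?_⟩,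
    fun h h₁ h₂ => hle h ⟨h₁, h₂⟩⟩
  · refine le_antisymm (hle _ min_zero_mem k) ((obstacle_le k).trans' ?_)
    unfold obstacle
    rcases le_abs.1 hk with hk | hk <;> omega
  · simpa using le_shift 1 0 (fun k => by unfold obstacle; omega) k
  · have := le_shift (-1) 1 (fun k => by unfold obstacle; omega) (k + 1)
    rw [add_neg_cancel_right] at this
    omega

theorem exists_isProfile (hpq : IsCoprime p q) : ∃ θ, IsProfile p q θ := by
  obtain ⟨N, hN⟩ := exists_support_bound hpq
  obtain ⟨g₀, hg₀, -⟩ := exists_isStep_le_of_obstacle_le p q le_rfl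
  obtain ⟨θ, hle, heq⟩ := exists_pointwise_least (S := {g | IsStep p q g}) ⟨g₀, hg₀⟩ fun k =>
    ⟨min 0 (min k (-|N|)), by
      rintro _ ⟨g, hg, rfl⟩
      have h₁ := hg.monotone (min_le_left k (-|N|))
      have h₂ := hN g hg (min k (-|N|)) <| by
        have := le_abs_self N
        have := neg_le_abs (min k (-|N|))
        omega
      exact h₂.symm.trans_le h₁⟩
  refine ⟨θ, superharmonic_of_touching fun x => ?_,
    eventually_cofinite_of_le_abs (R := N) fun k hk => ?_, fun h h₁ h₂ k => ?_⟩
  · obtain ⟨g, hg, hx⟩ := heq x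
    exact ⟨g, hg.superharmonic x, hx.symm, fun y _ => hle g hg y⟩
  · obtain ⟨g, hg, hx⟩ := heq k
    exact hx.symm.trans (hN g hg k hk)
  · obtain ⟨n, hn, hnh⟩ := exists_obstacle_le h₂
    obtain ⟨g, hg, hgh⟩ := exists_isStep_le_of_obstacle_le p q hn
    exact (hle g hg k).trans (hgh h h₁ hnh k)

end Level

namespace IsProfile

variable {p q : ℤ} {θ : ℤ → ℤ}

theorem neg (hθ : IsProfile p q θ) : IsProfile (-p) (-q) θ := by
  have hlap (g : ℤ → ℤ) (k : ℤ) : lap (-p) (-q) g k = lap p q g k := by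
    rw [lap_neg_left, lap_neg_right]
  exact ⟨fun k => (hlap θ k).trans_le (hθ.superharmonic k), hθ.eventually_eq,
    fun g hg => hθ.le g fun k => (hlap g k).symm.trans_le (hg k)⟩

theorem superharmonic_shift (hθ : IsProfile p q θ) (n c : ℤ) :
    Superharmonic p q fun k => θ (k + n) + c := fun k =>
  (lap_add_shift p q θ n c k).trans_le (hθ.superharmonic _)

theorem eventually_shift_eq (hθ : IsProfile p q θ) (n : ℤ) :
    ∀ᶠ k in Filter.cofinite, θ (k + n) = min 0 (k + n) :=
  (add_left_injective n).tendsto_cofinite.eventually hθ.eventually_eq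

theorem le_shift (hθ : IsProfile p q θ) {g : ℤ → ℤ} (hg : Superharmonic p q g) (n : ℤ)
    (h : ∀ᶠ k in Filter.cofinite, min n k ≤ g k) (k : ℤ) : θ (k + -n) + n ≤ g k := by
  have := hθ.le (fun k => g (k + n) + -n)
    (fun k => (lap_add_shift p q g n (-n) k).trans_le (hg _))
    (((add_left_injective n).tendsto_cofinite.eventually h).mono fun k hk => by omega) (k + -n)
  rw [neg_add_cancel_right] at this
  omega

theorem isStep (hθ : IsProfile p q θ) : IsStep p q θ where
  superharmonic := hθ.superharmonic
  eventually_eq := hθ.eventually_eq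
  monotone := monotone_int_of_le_succ fun k => by
    simpa only [add_zero] using hθ.le _ (hθ.superharmonic_shift 1 0)
      ((hθ.eventually_shift_eq 1).mono fun k hk => by omega) k
  antitone_sub := antitone_int_of_succ_le fun k => by
    have := hθ.le _ (hθ.superharmonic_shift (-1) 1)
      ((hθ.eventually_shift_eq (-1)).mono fun k hk => by omega) (k + 1)
    rw [add_neg_cancel_right] at this
    omega

theorem reflect (hθ : IsProfile p q θ) (k : ℤ) : θ (-k) = θ k - k := by
  have h (k : ℤ) : θ k ≤ θ (-k) + k := hθ.le _ hθ.isStep.reflect.superharmonic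
    (hθ.isStep.reflect.eventually_eq.mono fun _ hk => hk.ge) k
  have h₁ := h k
  have h₂ := h (-k)
  rw [neg_neg] at h₂
  omega

theorem lap_neg (hθ : IsProfile p q θ) (k : ℤ) : lap p q θ (-k) = lap p q θ k := by
  rw [← lap_reflect p q θ k]
  congr 1
  funext j
  rw [hθ.reflect, sub_add_cancel]

theorem neg_three_le_lap (hθ : IsProfile p q θ) (k : ℤ) : -3 ≤ lap p q θ k := by
  by_contra! hlap
  have update_le : Function.update θ k (θ k - 1) ≤ θ :=
    update_le_self_iff.2 (sub_one_lt (θ k)).le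
  have h := hθ.le (Function.update θ k (θ k - 1)) (superharmonic_of_touching fun x => ?_) ?_ k
  · rw [Function.update_self] at h
    omega
  · obtain rfl | hx := eq_or_ne x k
    · refine ⟨_, ?_, rfl, fun _ _ => le_rfl⟩
      have := update_le (x + p)
      have := update_le (x - p)
      have := update_le (x + q)
      have := update_le (x - q)
      simp only [lap, Function.update_self] at hlap ⊢
      linarith
    · exact ⟨θ, hθ.superharmonic x, Function.update_of_ne hx _ _, fun y _ => update_le y⟩
  · filter_upwards [hθ.eventually_eq, (Set.finite_singleton k).eventually_cofinite_notMem]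
      with j hj hjk
    rw [Function.update_of_ne hjk, hj]

end IsProfile

/-! ### Harmonic barriers -/

section Barrier

variable {p q : ℤ} {θ : ℤ → ℤ} {B : Set ℤ}

/-- The levels into which `θ` rises with slope one. -/
def risingLevels (θ : ℤ → ℤ) : Set ℤ := {k | θ k = θ (k - 1) + 1}

theorem mem_risingLevels {k : ℤ} : k ∈ risingLevels θ ↔ θ k = θ (k - 1) + 1 := Iff.rfl

namespace IsProfile

theorem eq_of_notMem_risingLevels (hθ : IsProfile p q θ) {k : ℤ} (hk : k ∉ risingLevels θ) :
    θ k = θ (k - 1) := by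
  have h₁ := hθ.isStep.monotone (show k - 1 ≤ k by omega)
  have h₂ := hθ.isStep.antitone_sub (show k - 1 ≤ k by omega)
  rw [mem_risingLevels] at hk
  dsimp only at h₂
  omega

theorem neg_mem_risingLevels_iff (hθ : IsProfile p q θ) {k : ℤ} :
    -k ∈ risingLevels θ ↔ θ (k + 1) = θ k := by
  have h₁ := hθ.reflect k
  have h₂ := hθ.reflect (k + 1)
  rw [neg_add, ← sub_eq_add_neg] at h₂
  rw [mem_risingLevels]
  omega

/-- On a component of `risingLevels θ` that does not reach `-∞` the profile could be lowered. -/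
theorem exists_pathIn_risingLevels_lt (hθ : IsProfile p q θ) {k : ℤ} (hk : k ∈ risingLevels θ)
    (r : ℤ) : ∃ j < r, PathIn (Step p q) (risingLevels θ) k j := by
  classical
  by_contra! hr
  let C : Set ℤ := {j | PathIn (Step p q) (risingLevels θ) k j}
  obtain ⟨R, hR⟩ := hθ.isStep.exists_eq_zero
  have C_finite : C.Finite := (Set.finite_Icc r R).subset fun j hj => by
    refine ⟨not_lt.1 fun h => hr j h hj, not_lt.1 fun h => ?_⟩
    have := mem_risingLevels.1 (PathIn.mem hj hk)
    rw [hR j (by omega), hR (j - 1) (by omega)] at this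
    omega
  have hsuper : Superharmonic p q (C.piecewise (fun j => θ (j + -1) + 0) θ) :=
    (hθ.superharmonic_shift (-1) 0).piecewise hθ.superharmonic fun x hx y hy hxy => by
      have hy' : y ∉ risingLevels θ := fun h => hy (PathIn.trans hx (.single hxy h))
      have hx' := mem_risingLevels.1 (PathIn.mem hx hk)
      simp only [add_zero, ← sub_eq_add_neg]
      exact ⟨(hθ.eq_of_notMem_risingLevels hy').le, by omega⟩
  have h := hθ.le _ hsuper (by
    filter_upwards [hθ.eventually_eq, C_finite.eventually_cofinite_notMem] with j hj hjC
    rw [Set.piecewise_eq_of_notMem _ _ _ hjC, hj]) k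
  rw [Set.piecewise_eq_of_mem C _ _ (PathIn.refl k), add_zero, ← sub_eq_add_neg] at h
  have := mem_risingLevels.1 hk
  omega

/-- On a component of `{j | θ j < j}` that does not reach `+∞` a translate of the profile could be
lowered. -/
theorem exists_pathIn_lt_self_gt (hθ : IsProfile p q θ) {k : ℤ} (hk : θ k < k) (r : ℤ) :
    ∃ j > r, PathIn (Step p q) {j | θ j < j} k j := by
  classical
  by_contra! hr
  let C : Set ℤ := {j | PathIn (Step p q) {j | θ j < j} k j}
  obtain ⟨R, hR⟩ := hθ.isStep.exists_eq_self
  obtain ⟨n, hn, hnR⟩ : ∃ n, 0 ≤ n ∧ k - n ≤ R := ⟨max 0 (k - R), by omega, by omega⟩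
  have C_finite : C.Finite := (Set.finite_Icc R r).subset fun j hj => by
    refine ⟨not_lt.1 fun h => ?_, not_lt.1 fun h => hr j h hj⟩
    have : θ j < j := PathIn.mem (X := {j | θ j < j}) hj hk
    rw [hR j h.le] at this
    omega
  have hsuper : Superharmonic p q (C.piecewise θ fun j => θ (j + -n) + n) :=
    hθ.superharmonic.piecewise (hθ.superharmonic_shift (-n) n) fun x hx y hy hxy => by
      have hyθ : y ≤ θ y := not_lt.1 fun h => hy (PathIn.trans hx (.single hxy h))
      have hx := hθ.isStep.antitone_sub (show x + -n ≤ x by omega)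
      have := hθ.isStep.le_self (y + -n)
      dsimp only at hx
      constructor <;> omega
  have h := hθ.le_shift hsuper n (by
    filter_upwards [hθ.eventually_shift_eq (-n), C_finite.eventually_cofinite_notMem] with j hj hjC
    rw [Set.piecewise_eq_of_notMem _ _ _ hjC, hj]
    omega) k
  rw [Set.piecewise_eq_of_mem C _ _ (PathIn.refl k), hR (k + -n) (by omega)] at h
  omega

end IsProfile

/-- A finite set of levels that separates the levels near `-∞` from those near `+∞`. -/
structure IsBarrier (p q : ℤ) (B : Set ℤ) : Prop where
  finite : B.Finite
  nonempty : B.Nonempty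
  not_pathIn : ∀ s t, (∀ b ∈ B, b < s) → (∀ b ∈ B, t < b) → ¬ PathIn (Step p q) Bᶜ s t

/-- A connected barrier of levels at which `θ` is harmonic. -/
structure IsHarmonicBarrier (p q : ℤ) (θ : ℤ → ℤ) (B : Set ℤ) : Prop extends IsBarrier p q B where
  connected : ∀ s ∈ B, ∀ t ∈ B, PathIn (Step p q) B s t
  lap_eq_zero : ∀ b ∈ B, lap p q θ b = 0

namespace IsBarrier

theorem neg (hB : IsBarrier p q B) : IsBarrier p q (Neg.neg ⁻¹' B) where
  finite := hB.finite.preimage neg_injective.injOn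
  nonempty := hB.nonempty.preimage neg_surjective
  not_pathIn s t hs ht hst := by
    have hs' : ∀ b ∈ B, -s < b := fun b hb => by
      have := hs (-b) (by simpa using hb)
      omega
    have ht' : ∀ b ∈ B, b < -t := fun b hb => by
      have := ht (-b) (by simpa using hb)
      omega
    have hpath : PathIn (Step p q) Bᶜ (-s) (-t) :=
      hst.map (fun _ _ => Step.neg) fun _ hb => hb
    exact hB.not_pathIn _ _ ht' hs'
      (hpath.symm (fun _ _ => Step.symm) fun hb => lt_irrefl _ (hs' _ hb))

theorem shift (hB : IsBarrier p q B) (n : ℤ) : IsBarrier p q ((· + n) ⁻¹' B) where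
  finite := hB.finite.preimage (add_left_injective n).injOn
  nonempty := hB.nonempty.preimage (add_right_surjective n)
  not_pathIn s t hs ht hst := by
    refine hB.not_pathIn (s + n) (t + n) (fun b hb => ?_) (fun b hb => ?_)
      (hst.map (fun _ _ => Step.add_right n) fun _ hb => hb)
    · have := hs (b - n) (by simpa using hb)
      omega
    · have := ht (b - n) (by simpa using hb)
      omega

theorem exists_mem_risingLevels (hB : IsBarrier p q B) (hθ : IsProfile p q θ)
    (h : ∀ b ∈ B, b + 1 ∈ risingLevels θ) : ∃ b ∈ B, b ∈ risingLevels θ := by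
  by_contra! hflat
  obtain ⟨r, hr⟩ := hB.finite.bddBelow
  obtain ⟨m, hm, hmax⟩ := Set.exists_max_image B id hB.finite hB.nonempty
  obtain ⟨j, hj, hpath⟩ := hθ.exists_pathIn_risingLevels_lt (h m hm) r
  exact hB.not_pathIn _ _ (fun b hb => Int.lt_add_one_iff.2 (hmax b hb))
    (fun b hb => hj.trans_le (hr hb)) (hpath.mono fun b hb hbB => hflat b hbB hb)

theorem eq_self_of_le (hB : IsBarrier p q B) (hθ : IsProfile p q θ) (h : ∀ b ∈ B, θ b = b) {s : ℤ}
    (hs : ∀ b ∈ B, s ≤ b) : θ s = s := by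
  by_contra hne
  have hlt : θ s < s := lt_of_le_of_ne (hθ.isStep.le_self s) hne
  obtain ⟨r, hr⟩ := hB.finite.bddAbove
  obtain ⟨j, hj, hpath⟩ := hθ.exists_pathIn_lt_self_gt hlt r
  exact hB.not_pathIn _ _ (fun b hb => (hr hb).trans_lt hj)
    (fun b hb => (hs b hb).lt_of_ne fun hsb => hne (h s (hsb ▸ hb)))
    ((hpath.symm (fun _ _ => Step.symm) hlt).mono fun b hb hbB => hb.ne (h b hbB))

end IsBarrier

namespace IsProfile

/-- The minimum principle for `fun j => θ (j - 1) - θ j`, which is at least `-1`. -/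
theorem slope_one_spread (hθ : IsProfile p q θ) {k : ℤ} (hlap : lap p q θ k = 0)
    (hk : k ∈ risingLevels θ) :
    lap p q θ (k - 1) = 0 ∧ ∀ t, Step p q k t → t ∈ risingLevels θ := by
  let u : ℤ → ℤ := fun j => θ (j + -1) - θ j
  have u_eq_iff (j : ℤ) : u j = -1 ↔ j ∈ risingLevels θ := by
    simp only [u, mem_risingLevels, ← sub_eq_add_neg]
    omega
  have u_ge (j : ℤ) : -1 ≤ u j := by
    have := hθ.isStep.antitone_sub (show j + -1 ≤ j by omega)
    dsimp only [u] at this ⊢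
    omega
  have u_lap : lap p q u k = lap p q θ (k - 1) := by
    rw [lap_sub, lap_comp_add_right, hlap, sub_zero, sub_eq_add_neg]
  have uk : u k = -1 := (u_eq_iff k).2 hk
  refine ⟨le_antisymm (hθ.superharmonic _) ?_, fun t hkt => (u_eq_iff t).1 ?_⟩
  · rw [← u_lap, ← lap_const p q (-1) k]
    exact lap_le_lap_of_step uk.symm fun y _ => u_ge y
  · rw [← uk]
    exact eq_of_step_of_lap_nonpos (u_lap.trans_le (hθ.superharmonic _))
      (fun y _ => uk.trans_le (u_ge y)) hkt

end IsProfile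

namespace IsHarmonicBarrier

theorem neg (hB : IsHarmonicBarrier p q θ B) (hθ : IsProfile p q θ) :
    IsHarmonicBarrier p q θ (Neg.neg ⁻¹' B) where
  toIsBarrier := hB.toIsBarrier.neg
  connected s hs t ht := by
    simpa only [neg_neg] using (hB.connected _ hs _ ht).map (Z := Neg.neg ⁻¹' B)
      (fun _ _ => Step.neg) fun b hb => by simpa using hb
  lap_eq_zero b hb := (hθ.lap_neg b).symm.trans (hB.lap_eq_zero _ hb)

theorem subset_risingLevels (hB : IsHarmonicBarrier p q θ B) (hθ : IsProfile p q θ)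
    (h : ∃ b ∈ B, b ∈ risingLevels θ) : B ⊆ risingLevels θ := fun t ht => by
  obtain ⟨s, hs, hs'⟩ := h
  exact ((hB.connected s hs t ht).mem_of_closed (Y := B ∩ risingLevels θ) ⟨hs, hs'⟩
    fun a ha b hb hab => ⟨hb, (hθ.slope_one_spread (hB.lap_eq_zero a ha.1) ha.2).2 b hab⟩).2

theorem pred (hB : IsHarmonicBarrier p q θ B) (hθ : IsProfile p q θ) (h : B ⊆ risingLevels θ) :
    IsHarmonicBarrier p q θ ((· + 1) ⁻¹' B) ∧ (· + 1) ⁻¹' B ⊆ risingLevels θ := by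
  have hpred : IsHarmonicBarrier p q θ ((· + 1) ⁻¹' B) :=
    { toIsBarrier := hB.shift 1
      connected := fun s hs t ht => by
        simpa using (hB.connected _ hs _ ht).map (Z := (· + 1) ⁻¹' B)
          (fun _ _ => Step.add_right (-1)) fun b hb => by simpa using hb
      lap_eq_zero := fun b hb => by
        simpa using (hθ.slope_one_spread (hB.lap_eq_zero _ hb) (h hb)).1 }
  exact ⟨hpred, hpred.subset_risingLevels hθ (hpred.exists_mem_risingLevels hθ fun b hb => h hb)⟩

theorem eq_sub_add (hB : IsHarmonicBarrier p q θ B) (hθ : IsProfile p q θ)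
    (h : B ⊆ risingLevels θ) (n : ℕ) : ∀ b ∈ B, θ b = θ (b - n) + n := by
  induction n generalizing B with
  | zero => simp
  | succ n ih =>
    intro b hb
    rw [mem_risingLevels.1 (h hb), ih (hB.pred hθ h).1 (hB.pred hθ h).2 (b - 1) (by simpa using hb)]
    push_cast
    ring_nf

theorem eq_self_of_le (hB : IsHarmonicBarrier p q θ B) (hθ : IsProfile p q θ)
    (h : ∃ b ∈ B, b ∈ risingLevels θ) {s : ℤ} (hs : ∀ b ∈ B, s ≤ b) : θ s = s := by
  refine hB.toIsBarrier.eq_self_of_le hθ (fun b hb => ?_) hs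
  obtain ⟨R, hR⟩ := hθ.isStep.exists_eq_self
  have := hB.eq_sub_add hθ (hB.subset_risingLevels hθ h) (b - R).toNat b hb
  rw [hR (b - (b - R).toNat) (by omega)] at this
  omega

theorem eq_self_or_eq_zero (hB : IsHarmonicBarrier p q θ B) (hθ : IsProfile p q θ) :
    (∀ s, (∀ b ∈ B, s ≤ b) → θ s = s) ∨ ∀ s, (∀ b ∈ B, b ≤ s) → θ s = 0 := by
  by_cases hrise : ∃ b ∈ B, b ∈ risingLevels θ
  · exact .inl fun s => hB.eq_self_of_le hθ hrise
  by_cases hflat : ∃ b ∈ B, -b ∈ risingLevels θ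
  · obtain ⟨b, hb, hb'⟩ := hflat
    refine .inr fun s hs => ?_
    have := (hB.neg hθ).eq_self_of_le hθ ⟨-b, by simpa using hb, hb'⟩ (s := -s) fun c hc => by
      have := hs _ hc
      omega
    have := hθ.reflect s
    omega
  · refine absurd (hB.exists_mem_risingLevels hθ fun b hb => ?_) hrise
    by_contra hb'
    refine hflat ⟨b, hb, hθ.neg_mem_risingLevels_iff.2 ?_⟩
    simpa using hθ.eq_of_notMem_risingLevels hb'

end IsHarmonicBarrier

end Barrier

section LevelForm

variable {p q : ℤ} {v w : ℤ × ℤ}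

theorem mem_nbrs_iff_step : w ∈ nbrs v ↔ Step (1, 0) (0, 1) v w := by
  obtain ⟨x, y⟩ := v
  simp [nbrs, Step]

theorem form_add (p q : ℤ) (v w : ℤ × ℤ) : form p q (v + w) = form p q v + form p q w := by
  simp only [form, Prod.fst_add, Prod.snd_add]
  ring

theorem form_nsmul (p q : ℤ) (n : ℕ) (v : ℤ × ℤ) : form p q (n • v) = n * form p q v := by
  obtain ⟨x, y⟩ := v
  simp only [form, Prod.smul_mk, nsmul_eq_mul]
  ring

theorem form_add_right (p q : ℤ) (v : ℤ × ℤ) : form p q (v + (1, 0)) = form p q v + q := by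
  simp only [form, Prod.fst_add, Prod.snd_add]
  ring

theorem form_add_up (p q : ℤ) (v : ℤ × ℤ) : form p q (v + (0, 1)) = form p q v + -p := by
  simp only [form, Prod.fst_add, Prod.snd_add]
  ring

theorem form_neg (p q : ℤ) (v : ℤ × ℤ) : form p q (-v) = -form p q v := by
  simp only [form, Prod.fst_neg, Prod.snd_neg]
  ring

theorem form_neg_neg (p q : ℤ) (v : ℤ × ℤ) : form (-p) (-q) v = -form p q v := by
  simp only [form]
  ring

theorem step_form (p q : ℤ) (h : Step (1, 0) (0, 1) v w) :
    Step p q (form p q v) (form p q w) := by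
  have := h.map (form_add_right p q) (form_add_up p q)
  simp only [Step, sub_neg_eq_add, ← sub_eq_add_neg] at this ⊢
  tauto

theorem lap_form (p q : ℤ) (u : ℤ → ℤ) (v : ℤ × ℤ) :
    lap (1, 0) (0, 1) (fun v => u (form p q v)) v = lap p q u (form p q v) := by
  rw [lap_comp (form_add_right p q) (form_add_up p q), lap_neg_right]
  simp only [lap]
  ring

theorem exists_form_eq (hpq : IsCoprime p q) (k : ℤ) : ∃ v, form p q v = k := by
  obtain ⟨a, b, hab⟩ := hpq
  exact ⟨(k * b, -(k * a)), by simp only [form]; linear_combination k * hab⟩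

end LevelForm

/-! ### Crossing numbers -/

section Crossing

variable {p q : ℤ} {K : Set (ℤ × ℤ)} {a b c : ℤ × ℤ} {m n : ℤ → ℤ}

/-- The indicator function of the levels `c` of the horizontal ray of vertices that starts to the
right of a vertex of level `s`, for `q > 0`. -/
def rayIndicator (q s c : ℤ) : ℤ := if s < c ∧ q ∣ c - s then 1 else 0

theorem rayIndicator_add_right (hq : 0 < q) {s c : ℤ} (h : c ≠ s) :
    rayIndicator q s (c + q) = rayIndicator q s c := by
  refine if_congr ?_ rfl rfl
  rw [add_sub_right_comm, dvd_add_self_right]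
  refine and_congr_left fun hdvd => ⟨fun hlt => ?_, fun hlt => by omega⟩
  have := Int.le_of_dvd (by omega) (dvd_add_self_right.2 hdvd)
  omega

theorem rayIndicator_sub_sub (q s c d : ℤ) :
    rayIndicator q (s - d) (c - d) = rayIndicator q s c := by
  simp only [rayIndicator, sub_lt_sub_iff_right, sub_sub_sub_cancel_right]

theorem rayIndicator_add_left (hq : 0 < q) {s c : ℤ} (h : c ≠ s + q) :
    rayIndicator q (s + q) c = rayIndicator q s c := by
  rw [← rayIndicator_sub_sub q (s + q) c q, add_sub_cancel_right,
    ← rayIndicator_add_right hq fun h' => h (sub_eq_iff_eq_add.1 h'), sub_add_cancel]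

theorem sum_rayIndicator (hq : 0 < q) {s c : ℤ} (h : s + q ≤ c) :
    ∑ j ∈ Finset.range q.toNat, rayIndicator q (s + j) c = 1 := by
  have h₀ := Int.emod_nonneg (c - s) hq.ne'
  have h₁ := Int.emod_lt_of_pos (c - s) hq
  rw [Finset.sum_eq_single_of_mem ((c - s) % q).toNat (Finset.mem_range.2 (by omega))]
  · rw [Int.toNat_of_nonneg h₀, rayIndicator, if_pos]
    exact ⟨by omega, sub_sub c s _ ▸ Int.dvd_self_sub_emod⟩
  · intro j hj hne
    refine if_neg fun ⟨_, hdvd⟩ => hne ?_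
    have hj := Finset.mem_range.1 hj
    rw [← sub_sub] at hdvd
    have := Int.emod_eq_emod_iff_emod_sub_eq_zero.2 (Int.emod_eq_zero_of_dvd hdvd)
    rw [Int.emod_eq_of_lt (a := j) (by omega) (by omega)] at this
    omega

/-- The properties of the numbers `n s` of upward steps, minus downward steps, that a lattice path
from `a` to `b` in `K` makes from the horizontal ray to the right of a vertex of level `s`, where
vertices of equal level are identified. Moving the ray does not change the number as long as no
end of the ray is crossed. -/
structure IsCrossingNumber (p q : ℤ) (K : Set (ℤ × ℤ)) (a b : ℤ × ℤ) (n : ℤ → ℤ) : Prop where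
  add_right : ∀ s, s + q ∉ form p q '' K → n (s + q) = n s
  sub_left : ∀ s, s - p ∉ form p q '' K → n s - n (s - p) =
    rayIndicator q (s - p) (form p q b) - rayIndicator q (s - p) (form p q a)
  eventually_eq_zero : ∀ᶠ s in Filter.atTop, n s = 0
  eventually_sum_eq : ∀ᶠ s in Filter.atBot, ∑ j ∈ Finset.range q.toNat, n (s + j) = b.2 - a.2

namespace IsCrossingNumber

theorem zero (hq : 0 < q) (ha : a ∈ K) : IsCrossingNumber p q K a (a + (1, 0)) 0 where
  add_right _ _ := rfl
  sub_left s hs := by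
    rw [form_add_right, rayIndicator_add_right hq fun h => hs ⟨a, ha, h⟩, sub_self]
    rfl
  eventually_eq_zero := .of_forall fun _ => rfl
  eventually_sum_eq := by simp

theorem rayIndicator (hq : 0 < q) (ha : a ∈ K) :
    IsCrossingNumber p q K a (a + (0, 1)) fun s => rayIndicator q s (form p q a) where
  add_right s hs := rayIndicator_add_left hq fun h => hs ⟨a, ha, h⟩
  sub_left s _ := by rw [form_add_up, ← sub_eq_add_neg, rayIndicator_sub_sub]
  eventually_eq_zero := (Filter.eventually_ge_atTop (form p q a)).mono fun s hs =>
    if_neg fun h => hs.not_gt h.1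
  eventually_sum_eq := (Filter.eventually_le_atBot (form p q a - q)).mono fun s hs => by
    rw [sum_rayIndicator hq (by omega)]
    simp

theorem trans (hm : IsCrossingNumber p q K a b m) (hn : IsCrossingNumber p q K b c n) :
    IsCrossingNumber p q K a c (m + n) where
  add_right s hs := by rw [Pi.add_apply, hm.add_right s hs, hn.add_right s hs, Pi.add_apply]
  sub_left s hs := by
    rw [Pi.add_apply, Pi.add_apply, add_sub_add_comm, hm.sub_left s hs, hn.sub_left s hs]
    ring
  eventually_eq_zero := by
    filter_upwards [hm.eventually_eq_zero, hn.eventually_eq_zero] with s h₁ h₂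
    rw [Pi.add_apply, h₁, h₂, add_zero]
  eventually_sum_eq := by
    filter_upwards [hm.eventually_sum_eq, hn.eventually_sum_eq] with s h₁ h₂
    simp only [Pi.add_apply, Finset.sum_add_distrib, h₁, h₂]
    ring

theorem symm (hn : IsCrossingNumber p q K a b n) : IsCrossingNumber p q K b a (-n) where
  add_right s hs := congrArg Neg.neg (hn.add_right s hs)
  sub_left s hs := by
    rw [Pi.neg_apply, Pi.neg_apply, neg_sub_neg, ← neg_sub, hn.sub_left s hs, neg_sub]
  eventually_eq_zero := hn.eventually_eq_zero.mono fun s hs => by rw [Pi.neg_apply, hs, neg_zero]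
  eventually_sum_eq := hn.eventually_sum_eq.mono fun s hs => by
    simp only [Pi.neg_apply, Finset.sum_neg_distrib, hs, neg_sub]

theorem exists_of_step (hq : 0 < q) (ha : a ∈ K) (hb : b ∈ K) (hab : Step (1, 0) (0, 1) a b) :
    ∃ n, IsCrossingNumber p q K a b n := by
  rcases hab with rfl | rfl | rfl | rfl
  · exact ⟨_, zero hq ha⟩
  · exact ⟨_, (sub_add_cancel a (1, 0) ▸ zero hq hb).symm⟩
  · exact ⟨_, rayIndicator hq ha⟩
  · exact ⟨_, (sub_add_cancel a (0, 1) ▸ rayIndicator hq hb).symm⟩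

theorem exists_of_pathIn (hq : 0 < q) (ha : a ∈ K) (hab : PathIn (Step (1, 0) (0, 1)) K a b) :
    ∃ n, IsCrossingNumber p q K a b n := by
  induction hab with
  | refl =>
    obtain ⟨n, hn⟩ : ∃ n, IsCrossingNumber p q K a (a + (1, 0)) n := ⟨0, zero hq ha⟩
    exact ⟨_, hn.trans hn.symm⟩
  | tail hab hbc ih =>
    obtain ⟨m, hm⟩ := ih
    obtain ⟨n, hn⟩ := exists_of_step hq (PathIn.mem hab ha) hbc.2 hbc.1
    exact ⟨_, hm.trans hn⟩

theorem eq_of_pathIn (hn : IsCrossingNumber p q K a b n) (hf : form p q a = form p q b) {s t : ℤ}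
    (hs : s ∉ form p q '' K) (hst : PathIn (Step p q) (form p q '' K)ᶜ s t) : n t = n s := by
  have hsub (s : ℤ) (hs : s - p ∉ form p q '' K) : n (s - p) = n s := by
    have := hn.sub_left s hs
    rw [hf] at this
    omega
  refine (hst.mem_of_closed (Y := {t ∈ (form p q '' K)ᶜ | n t = n s}) ⟨hs, rfl⟩ ?_).2
  rintro x ⟨hx, hxs⟩ y hy hxy
  refine ⟨hy, hxs ▸ ?_⟩
  rcases hxy with rfl | rfl | rfl | rfl
  · simpa using (hsub (x + p) (by simpa using hx)).symm
  · exact hsub x hy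
  · exact hn.add_right x hy
  · simpa using (hn.add_right (x - q) (by simpa using hx)).symm

end IsCrossingNumber

theorem step_neg_neg_iff {s t : ℤ} : Step (-p) (-q) s t ↔ Step p q s t := by
  simp only [Step, ← sub_eq_add_neg, sub_neg_eq_add]
  tauto

theorem pathIn_add_mul {X : Set ℤ} (hq : 0 ≤ q) {s : ℤ} (hX : Set.Ici s ⊆ X) (k : ℕ) :
    PathIn (Step p q) X s (s + k * q) := by
  induction k with
  | zero => simpa using PathIn.refl s
  | succ k ih =>
    refine ih.trans (.single (.inr (.inr (.inl (by push_cast; ring)))) (hX ?_))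
    exact Set.mem_Ici.2 (le_add_of_nonneg_right (by positivity))

theorem pathIn_sub_mul {X : Set ℤ} (hq : 0 ≤ q) {s : ℤ} (hX : Set.Iic s ⊆ X) (k : ℕ) :
    PathIn (Step p q) X s (s - k * q) := by
  have neg_path := pathIn_add_mul (p := p) (X := Neg.neg ⁻¹' X) hq (s := -s)
    (fun t ht => hX (Set.mem_Iic.2 (neg_le_of_neg_le ht))) k
  have path := neg_path.map (Z := X) (fun _ _ => Step.neg) fun _ hb => hb
  rwa [neg_add, neg_neg, ← sub_eq_add_neg] at path

theorem exists_pathIn_of_le (hpq : IsCoprime p q) {X : Set ℤ} {N : ℤ} (hX : Set.Iic N ⊆ X) :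
    ∃ M, ∀ s ≤ M, ∀ t ≤ M, PathIn (Step p q) X s t := by
  obtain ⟨S, hS, hwindow⟩ := exists_window hpq
  have path_up : ∀ s ≤ N - S, PathIn (Step p q) X s (N - S) := fun s hs => by
    induction s, hs using Int.leInductionDown with
    | base => exact .refl _
    | pred s hs ih =>
      have := (hwindow (s - 1)).mono fun t ht => hX (show t ≤ N by have := ht.2; omega)
      exact (sub_add_cancel s 1 ▸ this).trans ih
  exact ⟨N - S, fun s hs t ht => (path_up s hs).trans
    ((path_up t ht).symm (fun _ _ => Step.symm) (hX (show t ≤ N by omega)))⟩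

/-- A path between the two sides of `form p q '' K` makes the crossing numbers vanish far below, so
that `a` and `b` have the same height. -/
theorem isBarrier_image_form_of_pos (hpq : IsCoprime p q) (hq : 0 < q)
    (hK : (form p q '' K).Finite) (ha : a ∈ K) (hab : PathIn (Step (1, 0) (0, 1)) K a b)
    (hne : a ≠ b) (hf : form p q a = form p q b) : IsBarrier p q (form p q '' K) := by
  refine ⟨hK, ⟨_, a, ha, rfl⟩, fun s t hs ht hst => hne ?_⟩
  obtain ⟨n, hn⟩ := IsCrossingNumber.exists_of_pathIn (p := p) hq ha hab
  have above : Set.Ici s ⊆ (form p q '' K)ᶜ := fun x hx hxK => (hs x hxK).not_ge hx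
  have below : Set.Iic t ⊆ (form p q '' K)ᶜ := fun x hx hxK => (ht x hxK).not_ge hx
  obtain ⟨N, hN⟩ := Filter.eventually_atTop.1 hn.eventually_eq_zero
  have n_s : n s = 0 := by
    have hpath : PathIn (Step p q) (form p q '' K)ᶜ s (s + (N - s).toNat * q) :=
      pathIn_add_mul hq.le above _
    rw [← hn.eq_of_pathIn hf (above Set.self_mem_Ici) hpath]
    exact hN _ (by nlinarith [Int.self_le_toNat (N - s)])
  obtain ⟨M, hM⟩ := exists_pathIn_of_le hpq below
  have n_low : ∀ r ≤ M, n r = 0 := fun r hr => by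
    have hpath : PathIn (Step p q) (form p q '' K)ᶜ t (t - (t - M).toNat * q) :=
      pathIn_sub_mul hq.le below _
    have hle : t - (t - M).toNat * q ≤ M := by nlinarith [Int.self_le_toNat (t - M)]
    have hrs := hst.trans (hpath.trans (hM _ hle r hr))
    exact (hn.eq_of_pathIn hf (above Set.self_mem_Ici) hrs).trans n_s
  obtain ⟨r, hsum, hr⟩ :=
    (hn.eventually_sum_eq.and (Filter.eventually_le_atBot (M - q))).exists
  rw [Finset.sum_eq_zero fun j hj => n_low _ (by have := Finset.mem_range.1 hj; omega)] at hsum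
  have hsnd : a.2 = b.2 := by omega
  simp only [form, hsnd, sub_left_inj] at hf
  exact Prod.ext (mul_left_cancel₀ hq.ne' hf) hsnd

theorem isBarrier_image_form (hpq : IsCoprime p q) (hK : (form p q '' K).Finite) (ha : a ∈ K)
    (hab : PathIn (Step (1, 0) (0, 1)) K a b) (hne : a ≠ b) (hf : form p q a = form p q b) :
    IsBarrier p q (form p q '' K) := by
  rcases lt_trichotomy q 0 with hq | rfl | hq
  · have himage : form (-p) (-q) '' K = Neg.neg ⁻¹' (form p q '' K) := by
      ext s
      simp [form_neg_neg, neg_eq_iff_eq_neg]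
    have hB : IsBarrier (-p) (-q) (form (-p) (-q) '' K) :=
      isBarrier_image_form_of_pos hpq.neg_neg (neg_pos.2 hq)
        (himage ▸ hK.preimage neg_injective.injOn) ha hab hne
        (by rw [form_neg_neg, form_neg_neg, hf])
    have hstep : (Step p q : ℤ → ℤ → Prop) = Step (-p) (-q) :=
      funext₂ fun _ _ => propext step_neg_neg_iff.symm
    have hB' := himage ▸ hB.neg
    rw [← Set.preimage_comp, neg_comp_neg, Set.preimage_id] at hB'
    exact ⟨hB'.finite, hB'.nonempty, fun s t hs ht => hstep ▸ hB'.not_pathIn s t hs ht⟩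
  · have hp : p = 1 ∨ p = -1 := Int.isUnit_iff.1 (isCoprime_zero_right.1 hpq)
    have haK : form p 0 a ∈ form p 0 '' K := ⟨a, ha, rfl⟩
    refine ⟨hK, ⟨_, haK⟩, fun s t hs ht hst => (ht _ haK).not_gt ?_⟩
    refine hst.mem_of_closed (Y := Set.Ioi (form p 0 a)) (hs _ haK) fun x hx y hy hxy => ?_
    have hya : y ≠ form p 0 a := fun h => hy (h ▸ haK)
    rw [Set.mem_Ioi] at hx ⊢
    simp only [Step] at hxy
    omega
  · exact isBarrier_image_form_of_pos hpq hq hK ha hab hne hf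

end Crossing

/-! ### Relaxations -/

section Relaxation

variable {φ η H : ℤ × ℤ → ℤ} {ψ : ℕ → ℤ × ℤ → ℤ}

theorem lap_single (v w : ℤ × ℤ) :
    lap (1, 0) (0, 1) (Pi.single v 1) w = if w = v then -4 else if v ∈ nbrs w then 1 else 0 := by
  obtain ⟨a, b⟩ := v
  obtain ⟨c, d⟩ := w
  simp only [lap, Pi.single_apply, nbrs, Finset.mem_insert, Finset.mem_singleton, Prod.mk.injEq,
    Prod.mk_add_mk, Prod.mk_sub_mk, add_zero, sub_zero]
  split_ifs <;> omega

theorem topple_apply (v : ℤ × ℤ) (φ : ℤ × ℤ → ℤ) (w : ℤ × ℤ) :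
    topple v φ w = φ w + lap (1, 0) (0, 1) (Pi.single v 1) w := by
  simp only [topple, lap_single]
  split_ifs <;> omega

theorem IsState.topple {v : ℤ × ℤ} (hφ : IsState φ) (hv : 4 ≤ φ v) : IsState (topple v φ) := by
  intro w
  have := hφ w
  simp only [Sandpile.topple]
  split_ifs with hwv
  · subst hwv; omega
  all_goals omega

theorem IsRelaxation.isState (hψ : IsRelaxation φ ψ) (hφ : IsState φ) (i : ℕ) : IsState (ψ i) := by
  induction i with
  | zero => rwa [hψ.1]
  | succ i ih =>
    obtain h | ⟨v, hv, h⟩ := hψ.2 i <;> rw [h]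
    exacts [ih, ih.topple hv]

theorem exists_recurrent_enumeration (α : Type*) [Countable α] [Nonempty α] :
    ∃ s : ℕ → α, ∀ x, ∃ᶠ i in Filter.atTop, s i = x := by
  obtain ⟨e, he⟩ := exists_surjective_nat α
  refine ⟨fun i => e i.unpair.1, fun x => Filter.frequently_atTop.2 fun N => ?_⟩
  obtain ⟨m, rfl⟩ := he x
  exact ⟨Nat.pair m N, Nat.right_le_pair m N, by simp⟩

theorem eventually_lap_eq {G ι : Type*} [AddCommGroup G] {l : Filter ι} {U : ι → G → ℤ}
    {u : G → ℤ} (h : ∀ x, ∀ᶠ i in l, U i x = u x) (a b x : G) :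
    ∀ᶠ i in l, lap a b (U i) x = lap a b u x := by
  filter_upwards [h x, h (x + a), h (x - a), h (x + b), h (x - b)] with i h₀ h₁ h₂ h₃ h₄
  simp only [lap, h₀, h₁, h₂, h₃, h₄]

open Classical in
/-- The number of topplings at each vertex when the vertices `s 0, s 1, …` are toppled in this
order, starting from the state `η` and omitting illegal topplings. -/
noncomputable def odometer (η : ℤ × ℤ → ℤ) (s : ℕ → ℤ × ℤ) : ℕ → ℤ × ℤ → ℤ
  | 0 => fun _ => 0
  | i + 1 => if 4 ≤ η (s i) + lap (1, 0) (0, 1) (odometer η s i) (s i)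
      then fun v => odometer η s i v + (Pi.single (s i) 1 : ℤ × ℤ → ℤ) v else odometer η s i

theorem odometer_mono (η : ℤ × ℤ → ℤ) (s : ℕ → ℤ × ℤ) (v : ℤ × ℤ) :
    Monotone fun i => odometer η s i v := by
  refine monotone_nat_of_le_succ fun i => ?_
  simp only [odometer]
  split_ifs
  · have : (0 : ℤ × ℤ → ℤ) ≤ Pi.single (s i) 1 := Pi.single_nonneg.2 zero_le_one
    exact le_add_of_nonneg_right (this v)
  · exact le_rfl

theorem isRelaxation_odometer (η : ℤ × ℤ → ℤ) (s : ℕ → ℤ × ℤ) :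
    IsRelaxation η fun i v => η v + lap (1, 0) (0, 1) (odometer η s i) v := by
  refine ⟨funext fun v => by simp only [odometer, lap_const, add_zero], fun i => ?_⟩
  simp only [odometer]
  split_ifs with h
  · refine .inr ⟨s i, h, funext fun v => ?_⟩
    rw [topple_apply, lap_add, add_assoc]
  · exact .inl rfl

/-- The least action principle. -/
theorem odometer_le (s : ℕ → ℤ × ℤ) (hH₀ : ∀ v, 0 ≤ H v)
    (hH : ∀ v, η v + lap (1, 0) (0, 1) H v < 4) (i : ℕ) (v : ℤ × ℤ) : odometer η s i v ≤ H v := by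
  induction i generalizing v with
  | zero => exact hH₀ v
  | succ i ih =>
    simp only [odometer]
    split_ifs with hlegal
    · obtain rfl | hv := eq_or_ne v (s i)
      · have hne : odometer η s i (s i) ≠ H (s i) := fun heq => by
          have := lap_le_lap_of_step (a := (1, 0)) (b := (0, 1)) heq fun y _ => ih y
          have := hH (s i)
          omega
        simpa only [Pi.single_eq_same, Int.add_one_le_iff] using (ih _).lt_of_ne hne
      · simpa only [Pi.single_eq_of_ne hv, add_zero] using ih v
    · exact ih v

theorem not_legal_of_eventually_eq {s : ℕ → ℤ × ℤ} {u : ℤ × ℤ → ℤ} {v : ℤ × ℤ}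
    (hs : ∃ᶠ i in Filter.atTop, s i = v) (hu : ∀ w, ∀ᶠ i in Filter.atTop, odometer η s i w = u w) :
    η v + lap (1, 0) (0, 1) u v < 4 := by
  by_contra! hv
  obtain ⟨i, rfl, hi, hi', hlap⟩ := (hs.and_eventually ((hu v).and
    (((Filter.tendsto_add_atTop_nat 1).eventually (hu v)).and
      (eventually_lap_eq hu (1, 0) (0, 1) v)))).exists
  rw [← hlap] at hv
  simp only [odometer, if_pos hv, Pi.single_eq_same] at hi'
  omega

theorem exists_relaxation (hη : IsState η) (hH₀ : ∀ v, 0 ≤ H v)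
    (hH : ∀ v, η v + lap (1, 0) (0, 1) H v < 4) :
    ∃ u : ℤ × ℤ → ℤ, (∀ v, 0 ≤ u v) ∧ (∀ v, u v ≤ H v) ∧
      RelaxesTo η fun v => η v + lap (1, 0) (0, 1) u v := by
  obtain ⟨s, hs⟩ := exists_recurrent_enumeration (ℤ × ℤ)
  have bound : ∀ i v, odometer η s i v ≤ H v := odometer_le s hH₀ hH
  let u v := ⨆ i, odometer η s i v
  have lim : ∀ v, ∀ᶠ i in Filter.atTop, odometer η s i v = u v := fun v => by
    have := tendsto_atTop_ciSup (odometer_mono η s v) ⟨H v, by rintro _ ⟨i, rfl⟩; exact bound i v⟩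
    rwa [nhds_discrete, Filter.tendsto_pure] at this
  have lap_lim := eventually_lap_eq lim (1, 0) (0, 1)
  have state := (isRelaxation_odometer η s).isState hη
  refine ⟨u, fun v => ?_, fun v => ?_, hη,
    ⟨fun v => ?_, fun v => not_legal_of_eventually_eq (hs v) lim⟩,
    _, isRelaxation_odometer η s, fun v => ?_⟩
  · obtain ⟨i, hi⟩ := (lim v).exists
    rw [← hi]
    exact odometer_mono η s v (Nat.zero_le i)
  · obtain ⟨i, hi⟩ := (lim v).exists
    exact hi ▸ bound i v
  · obtain ⟨i, hi⟩ := (lap_lim v).exists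
    simpa only [hi] using state i v
  · exact Filter.eventually_atTop.1 ((lap_lim v).mono fun i hi => by rw [hi])

end Relaxation

/-! ### Half-planes and territories -/

section HalfPlane

variable {p q R : ℤ} {v w e : ℤ × ℤ}

theorem tendsto_form_add_nsmul (he : 0 < form p q e) (v : ℤ × ℤ) :
    Filter.Tendsto (fun n : ℕ => form p q (v + n • e)) Filter.atTop Filter.atTop := by
  simp only [form_add, form_nsmul]
  exact Filter.tendsto_atTop_add_const_left _ _
    (tendsto_natCast_atTop_atTop.atTop_mul_const' he)

theorem pathIn_add_nsmul {G : Type*} [AddCommGroup G] {a b e x : G} {X : Set G}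
    (he : Step a b 0 e) (hX : ∀ n : ℕ, x + n • e ∈ X) (n : ℕ) :
    PathIn (Step a b) X x (x + n • e) := by
  induction n with
  | zero => simpa only [zero_nsmul, add_zero] using PathIn.refl x
  | succ n ih =>
    refine ih.trans (.single ?_ (hX _))
    simpa only [zero_add, succ_nsmul', add_left_comm] using he.add_right (x + n • e)

theorem pathIn_univ (v w : ℤ × ℤ) : PathIn (Step (1, 0) (0, 1)) Set.univ v w := by
  refine pathIn_univ_of_closure_eq_top (eq_top_iff.2 fun x _ => ?_) v w
  have hx : x = x.1 • (1, 0) + x.2 • (0, 1) := by ext <;> simp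
  rw [hx]
  exact add_mem (zsmul_mem (AddSubgroup.subset_closure (.inl rfl)) _)
    (zsmul_mem (AddSubgroup.subset_closure (.inr rfl)) _)

theorem exists_steepest (hpq : IsCoprime p q) : ∃ e : ℤ × ℤ, Step (1, 0) (0, 1) 0 e ∧
    0 < form p q e ∧ ∀ v w, Step (1, 0) (0, 1) v w → form p q w ≤ form p q v + form p q e := by
  obtain ⟨e, he, hmax⟩ := (nbrs 0).exists_max_image (form p q) ⟨(1, 0), by simp [nbrs]⟩
  refine ⟨e, mem_nbrs_iff_step.1 he, ?_, fun v w hvw => ?_⟩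
  swap
  · have hstep := hvw.add_right (-v)
    rw [add_neg_cancel, ← sub_eq_add_neg, ← mem_nbrs_iff_step] at hstep
    have hle := hmax _ hstep
    rwa [← add_le_add_iff_left (form p q v), ← form_add, add_sub_cancel] at hle
  by_contra! hle
  have unit_le : ∀ f ∈ nbrs 0, form p q f ≤ 0 := fun f hf => (hmax f hf).trans hle
  simp only [nbrs, form, Finset.mem_insert, Finset.mem_singleton, forall_eq_or_imp, forall_eq,
    Prod.fst_zero, Prod.snd_zero, zero_add, zero_sub, mul_zero, mul_one, sub_zero] at unit_le
  obtain ⟨rfl, rfl⟩ : p = 0 ∧ q = 0 := by omega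
  exact not_isCoprime_zero_zero hpq

theorem pathIn_halfPlane (hpq : IsCoprime p q) (hv : R < form p q v) (hw : R < form p q w) :
    PathIn (Step (1, 0) (0, 1)) {x | R < form p q x} v w := by
  obtain ⟨e, he, he_pos, -⟩ := exists_steepest hpq
  obtain ⟨F, hF, hvw⟩ := (pathIn_univ v w).exists_finite
  obtain ⟨n, hn⟩ : ∃ n : ℕ, ∀ x ∈ F, R < form p q (x + n • e) :=
    ((Filter.eventually_all_finite hF).2 fun x _ =>
      (tendsto_form_add_nsmul he_pos x).eventually_gt_atTop R).exists
  have translated : PathIn (Step (1, 0) (0, 1)) {x | R < form p q x} (v + n • e) (w + n • e) :=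
    hvw.map (f := (· + n • e)) (fun _ _ => Step.add_right _) hn
  have ray : ∀ x, R < form p q x →
      PathIn (Step (1, 0) (0, 1)) {x | R < form p q x} x (x + n • e) := fun x hx =>
    pathIn_add_nsmul he (fun m => hx.trans_le <| by
      rw [form_add, form_nsmul]
      exact le_add_of_nonneg_right (mul_nonneg (Int.natCast_nonneg m) he_pos.le)) n
  exact (ray v hv).trans (translated.trans ((ray w hw).symm (fun _ _ => Step.symm) hw))

end HalfPlane

section Territory

variable {p q R : ℤ} {φ : ℤ × ℤ → ℤ} {T T' : Set (ℤ × ℤ)} {v w : ℤ × ℤ}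

theorem connected_induce_iff {V : Type*} {G : SimpleGraph V} {T : Set V} :
    (G.induce T).Connected ↔ T.Nonempty ∧ ∀ a ∈ T, ∀ b ∈ T, PathIn G.Adj T a b := by
  rw [SimpleGraph.connected_iff, and_comm, Set.nonempty_coe_sort]
  refine and_congr_right fun _ => ⟨fun h a ha b hb => ?_, fun h a b => ?_⟩
  · exact ((SimpleGraph.reachable_iff_reflTransGen _ _).1 (h ⟨a, ha⟩ ⟨b, hb⟩)).lift Subtype.val
      fun _ y hxy => ⟨hxy, y.2⟩
  · obtain ⟨a, ha⟩ := a
    obtain ⟨b, hb⟩ := b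
    rw [SimpleGraph.reachable_iff_reflTransGen]
    induction h a ha b hb with
    | refl => exact .refl
    | tail hx hxy ih => exact (ih (PathIn.mem hx ha)).tail hxy.1

theorem lattice_adj : lattice.Adj = Step (1, 0) (0, 1) :=
  funext₂ fun _ _ => propext mem_nbrs_iff_step

namespace IsTerritory

theorem pathIn (hT : IsTerritory φ T) (hv : v ∈ T) (hw : w ∈ T) :
    PathIn (Step (1, 0) (0, 1)) T v w :=
  lattice_adj ▸ (connected_induce_iff.1 hT.connected).2 v hv w hw

theorem mem_of_step (hT : IsTerritory φ T) (hv : v ∈ T) (h : Step (1, 0) (0, 1) v w)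
    (hw : φ w = 3) : w ∈ T := by
  by_contra hwT
  exact (hT.lt_three w hwT ⟨v, mem_nbrs_iff_step.2 h.symm, hv⟩).ne hw

theorem subset_of_mem (hT : IsTerritory φ T) (hT' : IsTerritory φ T') (hv : v ∈ T)
    (hv' : v ∈ T') : T ⊆ T' := fun _ hw =>
  (hT.pathIn hv hw).mem_of_closed hv' fun _ hx _ hy hxy =>
    hT'.mem_of_step hx hxy (hT.eq_three _ hy)

theorem add_nsmul_mem {e : ℤ × ℤ} (hT : IsTerritory φ T) (hv : v ∈ T)
    (he : Step (1, 0) (0, 1) 0 e) (h : ∀ n : ℕ, φ (v + n • e) = 3) (n : ℕ) : v + n • e ∈ T :=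
  (pathIn_add_nsmul (X := {x | φ x = 3}) he h n).mem_of_closed hv
    fun _ hx _ hy hxy => hT.mem_of_step hx hxy hy

end IsTerritory

/-- The vertices with three grains that are connected with vertices of arbitrarily high level. -/
def upperTerritory (p q : ℤ) (φ : ℤ × ℤ → ℤ) : Set (ℤ × ℤ) :=
  {v | φ v = 3 ∧ ∀ r, ∃ b, r < form p q b ∧ PathIn (Step (1, 0) (0, 1)) {w | φ w = 3} v b}

theorem mem_upperTerritory_of_step (hv : v ∈ upperTerritory p q φ)
    (h : Step (1, 0) (0, 1) v w) (hw : φ w = 3) : w ∈ upperTerritory p q φ := by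
  refine ⟨hw, fun r => ?_⟩
  obtain ⟨b, hb, hvb⟩ := hv.2 r
  exact ⟨b, hb, (PathIn.single h.symm hv.1).trans hvb⟩

theorem mem_upperTerritory_of_lt (hpq : IsCoprime p q) (hR : ∀ v, R < form p q v → φ v = 3)
    (hv : R < form p q v) : v ∈ upperTerritory p q φ := by
  refine ⟨hR v hv, fun r => ?_⟩
  obtain ⟨e, -, he_pos, -⟩ := exists_steepest hpq
  obtain ⟨n, hr, hn⟩ := (((tendsto_form_add_nsmul he_pos v).eventually_gt_atTop r).and
    ((tendsto_form_add_nsmul he_pos v).eventually_gt_atTop R)).exists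
  exact ⟨v + n • e, hr, (pathIn_halfPlane hpq hv hn).mono hR⟩

theorem pathIn_upperTerritory (hpq : IsCoprime p q) (hR : ∀ v, R < form p q v → φ v = 3)
    (hv : v ∈ upperTerritory p q φ) (hw : w ∈ upperTerritory p q φ) :
    PathIn (Step (1, 0) (0, 1)) (upperTerritory p q φ) v w := by
  obtain ⟨v', hv', hvv'⟩ := hv.2 R
  obtain ⟨w', hw', hww'⟩ := hw.2 R
  have path : PathIn (Step (1, 0) (0, 1)) {x | φ x = 3} v w :=
    hvv'.trans (((pathIn_halfPlane hpq hv' hw').mono hR).trans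
      (hww'.symm (fun _ _ => Step.symm) hw.1))
  exact path.restrict hv fun _ hx _ hy hxy => mem_upperTerritory_of_step hx hxy hy

theorem infinite_upperTerritory (hpq : IsCoprime p q) (hR : ∀ v, R < form p q v → φ v = 3) :
    (upperTerritory p q φ).Infinite := by
  obtain ⟨e, -, he_pos, -⟩ := exists_steepest hpq
  have lim := tendsto_form_add_nsmul he_pos 0
  refine Set.Infinite.of_image (form p q) (Set.infinite_of_not_bddAbove ?_)
  rintro ⟨M, hM⟩
  obtain ⟨n, hnM, hnR⟩ := ((lim.eventually_gt_atTop M).and (lim.eventually_gt_atTop R)).exists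
  exact (hM ⟨_, mem_upperTerritory_of_lt hpq hR hnR, rfl⟩).not_gt hnM

theorem isTerritory_upperTerritory (hpq : IsCoprime p q) (hφ : ∀ v, φ v ≤ 3)
    (hR : ∀ v, R < form p q v → φ v = 3) : IsTerritory φ (upperTerritory p q φ) where
  connected := connected_induce_iff.2 ⟨(infinite_upperTerritory hpq hR).nonempty,
    fun _ hv _ hw => lattice_adj ▸ pathIn_upperTerritory hpq hR hv hw⟩
  eq_three _ hv := hv.1
  lt_three w hw := fun ⟨_, hvw, hv⟩ => (hφ w).lt_of_ne fun h =>
    hw (mem_upperTerritory_of_step hv (mem_nbrs_iff_step.1 hvw).symm h)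
  nontrivial := (infinite_upperTerritory hpq hR).nontrivial

theorem IsTerritory.eq_upperTerritory (hT : IsTerritory φ T) (hpq : IsCoprime p q)
    (hφ : ∀ v, φ v ≤ 3) (hR : ∀ v, R < form p q v → φ v = 3) (hv : v ∈ T)
    (hvR : R < form p q v) : T = upperTerritory p q φ :=
  have hU := isTerritory_upperTerritory hpq hφ hR
  have hvU := mem_upperTerritory_of_lt hpq hR hvR
  (hT.subset_of_mem hU hv hvU).antisymm (hU.subset_of_mem hT hvU hv)

theorem neg_upperTerritory (hφ : ∀ v, φ (-v) = φ v) :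
    -upperTerritory p q φ = upperTerritory (-p) (-q) φ := by
  have neg_mem : ∀ {p q v}, v ∈ upperTerritory p q φ → -v ∈ upperTerritory (-p) (-q) φ := by
    refine fun {p q v} hv => ⟨(hφ v).trans hv.1, fun r => ?_⟩
    obtain ⟨b, hb, hvb⟩ := hv.2 r
    exact ⟨-b, by rwa [form_neg, form_neg_neg, neg_neg],
      hvb.map (fun _ _ => Step.neg) fun x hx => (hφ x).trans hx⟩
  refine Set.Subset.antisymm (fun v hv => ?_) fun v hv => ?_
  · simpa only [neg_neg] using neg_mem (Set.mem_neg.1 hv)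
  · exact Set.mem_neg.2 (by simpa only [neg_neg] using neg_mem hv)

end Territory

/-! ### States of the level -/

/-- The state `3 + Δ(θ ∘ F)`, in which the number of grains depends on the level only. -/
def levelState (p q : ℤ) (θ : ℤ → ℤ) (v : ℤ × ℤ) : ℤ := 3 + lap p q θ (form p q v)

/-- The toppling function `θ(F - n) + n - θ(F)`, which moves the state of `θ` up by `n` levels. -/
def shiftOdometer (p q : ℤ) (θ : ℤ → ℤ) (n : ℤ) (v : ℤ × ℤ) : ℤ :=
  θ (form p q v + -n) + n - θ (form p q v)

theorem levelState_eq_three_iff {p q : ℤ} {θ : ℤ → ℤ} {v : ℤ × ℤ} :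
    levelState p q θ v = 3 ↔ lap p q θ (form p q v) = 0 :=
  add_eq_left

theorem levelState_add_lap_shiftOdometer (p q : ℤ) (θ : ℤ → ℤ) (n : ℤ) (v : ℤ × ℤ) :
    levelState p q θ v + lap (1, 0) (0, 1) (shiftOdometer p q θ n) v =
      3 + lap p q θ (form p q v + -n) := by
  have hlap : lap (1, 0) (0, 1) (shiftOdometer p q θ n) v =
      lap p q θ (form p q v + -n) - lap p q θ (form p q v) := by
    rw [← lap_add_shift p q θ (-n) n, ← lap_sub]
    exact lap_form p q (fun k => θ (k + -n) + n - θ k) v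
  rw [hlap, levelState, add_assoc, add_sub_cancel]

namespace IsProfile

section State

variable {p q : ℤ} {θ : ℤ → ℤ}

theorem levelState_le (hθ : IsProfile p q θ) (v : ℤ × ℤ) : levelState p q θ v ≤ 3 :=
  add_le_of_nonpos_right (hθ.superharmonic _)

theorem isStable_levelState (hθ : IsProfile p q θ) : IsStable (levelState p q θ) :=
  ⟨fun _ => neg_le_iff_add_nonneg'.1 (hθ.neg_three_le_lap _),
    fun _ => Int.lt_add_one_of_le (hθ.levelState_le _)⟩

theorem levelState_neg (hθ : IsProfile p q θ) (v : ℤ × ℤ) :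
    levelState p q θ (-v) = levelState p q θ v := by
  rw [levelState, form_neg, hθ.lap_neg, levelState]

theorem levelState_neg_neg (hθ : IsProfile p q θ) :
    levelState (-p) (-q) θ = levelState p q θ := by
  funext v
  rw [levelState, form_neg_neg, lap_neg_left, lap_neg_right, hθ.lap_neg, levelState]

theorem exists_lap_eq_zero (hθ : IsProfile p q θ) : ∃ R, ∀ k, R < |k| → lap p q θ k = 0 := by
  obtain ⟨R, hR⟩ := hθ.isStep.exists_eq_zero
  have above : ∀ k, R + |p| + |q| < k → lap p q θ k = 0 := fun k hk => by
    obtain ⟨hp, hp'⟩ := abs_le.1 (le_refl |p|)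
    obtain ⟨hq, hq'⟩ := abs_le.1 (le_refl |q|)
    refine lap_eq_zero_of_step fun t ht => ?_
    rw [hR k (by omega), hR t (by rcases ht with rfl | rfl | rfl | rfl <;> omega)]
  refine ⟨R + |p| + |q|, fun k hk => ?_⟩
  rcases lt_abs.1 hk with hk | hk
  · exact above k hk
  · rw [← hθ.lap_neg]
    exact above _ hk

theorem exists_levelState_eq_three (hθ : IsProfile p q θ) :
    ∃ R, ∀ v, R < |form p q v| → levelState p q θ v = 3 :=
  hθ.exists_lap_eq_zero.imp fun _ hR _ hv => levelState_eq_three_iff.2 (hR _ hv)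

theorem exists_levelState_eq_three_of_lt_form (hθ : IsProfile p q θ) :
    ∃ R, ∀ v, R < form p q v → levelState p q θ v = 3 :=
  hθ.exists_levelState_eq_three.imp fun _ hR v hv => hR v (hv.trans_le (le_abs_self _))

end State

section UpperTerritory

variable {p q : ℤ} {θ : ℤ → ℤ} {v : ℤ × ℤ}

theorem isTerritory_upperTerritory (hθ : IsProfile p q θ) (hpq : IsCoprime p q) :
    IsTerritory (levelState p q θ) (upperTerritory p q (levelState p q θ)) :=
  hθ.exists_levelState_eq_three_of_lt_form.elim fun _ hR =>
    Sandpile.isTerritory_upperTerritory hpq hθ.levelState_le hR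

theorem eq_zero_of_step {k t : ℤ} (hθ : IsProfile p q θ) (hlap : lap p q θ k = 0)
    (hk : θ k = 0) (h : Step p q k t) : θ t = 0 := by
  have nonpos := hθ.isStep.nonpos
  have := nonpos (k + p)
  have := nonpos (k - p)
  have := nonpos (k + q)
  have := nonpos (k - q)
  simp only [lap] at hlap
  rcases h with rfl | rfl | rfl | rfl <;> omega

theorem eq_zero_of_mem (hθ : IsProfile p q θ)
    (hv : v ∈ upperTerritory p q (levelState p q θ)) : θ (form p q v) = 0 := by
  obtain ⟨R, hR⟩ := hθ.isStep.exists_eq_zero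
  obtain ⟨b, hb, hvb⟩ := hv.2 R
  have hbv := hvb.symm (fun _ _ => Step.symm) hv.1
  refine (hbv.mem_of_closed (Y := {x | levelState p q θ x = 3 ∧ θ (form p q x) = 0})
    ⟨hvb.mem hv.1, hR _ hb.le⟩ fun x hx y hy hxy => ⟨hy, ?_⟩).2
  exact hθ.eq_zero_of_step (levelState_eq_three_iff.1 hx.1) hx.2 (step_form p q hxy)

theorem form_pos_of_mem (hθ : IsProfile p q θ) (hpq : IsCoprime p q)
    (hv : v ∈ upperTerritory p q (levelState p q θ)) : 0 < form p q v := by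
  obtain ⟨e, he, he_pos, -⟩ := exists_steepest hpq
  have hstep : Step (1, 0) (0, 1) v (-e + v) := by
    simpa only [neg_zero, zero_add] using he.neg.add_right v
  have hzero := hθ.eq_zero_of_step (levelState_eq_three_iff.1 hv.1) (hθ.eq_zero_of_mem hv)
    (step_form p q hstep)
  have hle := hθ.isStep.le_self (form p q (-e + v))
  rw [hzero, form_add, form_neg] at hle
  omega

theorem form_notMem_risingLevels (hθ : IsProfile p q θ)
    (hv : v ∈ upperTerritory p q (levelState p q θ)) : form p q v ∉ risingLevels θ := by
  intro hrise
  obtain ⟨R, hR⟩ := hθ.isStep.exists_eq_zero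
  obtain ⟨b, hb, hvb⟩ := hv.2 R
  have hb_rise := (hvb.mem_of_closed
    (Y := {x | levelState p q θ x = 3 ∧ form p q x ∈ risingLevels θ}) ⟨hv.1, hrise⟩
    fun x hx y hy hxy => ⟨hy, (hθ.slope_one_spread (levelState_eq_three_iff.1 hx.1) hx.2).2 _
      (step_form p q hxy)⟩).2
  rw [mem_risingLevels, hR _ hb.le, hR _ (by omega)] at hb_rise
  omega

end UpperTerritory

section Relaxable

variable {p q : ℤ} {θ : ℤ → ℤ} {v : ℤ × ℤ}

theorem exists_lap_neg_of_mem (hθ : IsProfile p q θ) (hpq : IsCoprime p q)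
    (hv : v ∈ upperTerritory p q (levelState p q θ)) :
    ∃ n, 0 ≤ n ∧ lap p q θ (form p q v + -n) < 0 := by
  by_contra! hnonneg
  obtain ⟨e, he, he_pos, -⟩ := exists_steepest hpq.neg_neg
  rw [form_neg_neg, neg_pos] at he_pos
  have hmem : ∀ n : ℕ, v + n • e ∈ upperTerritory p q (levelState p q θ) :=
    (hθ.isTerritory_upperTerritory hpq).add_nsmul_mem hv he fun n => by
      rw [levelState_eq_three_iff, form_add, form_nsmul]
      refine (hθ.superharmonic _).antisymm ?_
      simpa only [neg_neg] using hnonneg (-(n * form p q e))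
        (neg_nonneg.2 (mul_nonpos_of_nonneg_of_nonpos (Int.natCast_nonneg n) he_pos.le))
  obtain ⟨n, hn⟩ := ((tendsto_form_add_nsmul (p := -p) (q := -q)
    (by rwa [form_neg_neg, neg_pos]) v).eventually_gt_atTop 0).exists
  rw [form_neg_neg, neg_pos] at hn
  exact hn.not_gt (hθ.form_pos_of_mem hpq (hmem n))

theorem shiftOdometer_nonneg (hθ : IsProfile p q θ) {n : ℤ} (hn : 0 ≤ n) (v : ℤ × ℤ) :
    0 ≤ shiftOdometer p q θ n v := by
  have : θ (form p q v) - form p q v ≤ θ (form p q v + -n) - (form p q v + -n) :=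
    hθ.isStep.antitone_sub (by omega)
  simp only [shiftOdometer]
  omega

theorem relaxable_add_single (hθ : IsProfile p q θ) (hpq : IsCoprime p q)
    (hv : v ∈ upperTerritory p q (levelState p q θ)) :
    Relaxable (levelState p q θ + Pi.single v 1) := by
  obtain ⟨n, hn, hlt⟩ := hθ.exists_lap_neg_of_mem hpq hv
  have hstate : IsState (levelState p q θ + Pi.single v 1) := by
    have hsingle : 0 ≤ (Pi.single v 1 : ℤ × ℤ → ℤ) := Pi.single_nonneg.2 zero_le_one
    exact fun w => add_nonneg (hθ.isStable_levelState.1 w) (hsingle w)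
  obtain ⟨u, -, -, hu⟩ := exists_relaxation hstate (hθ.shiftOdometer_nonneg hn) fun w => by
    rw [Pi.add_apply, add_right_comm, levelState_add_lap_shiftOdometer]
    rcases eq_or_ne w v with rfl | hw
    · rw [Pi.single_eq_same]
      omega
    · have := hθ.superharmonic (form p q w + -n)
      rw [Pi.single_eq_of_ne hw]
      omega
  exact ⟨_, hu⟩

end Relaxable

end IsProfile

/-! ### Waves -/

section Wave

variable {φ : ℤ × ℤ → ℤ} {T : Set (ℤ × ℤ)} {v w : ℤ × ℤ}

/-- The vertices toppled at the start of a wave sent from the vertex `v` of the territory `T`. -/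
def waveFront (T : Set (ℤ × ℤ)) (v : ℤ × ℤ) : Set (ℤ × ℤ) := insert v {u | u ∈ nbrs v ∧ u ∈ T}

theorem waveFront_subset (hv : v ∈ T) : waveFront T v ⊆ T :=
  Set.insert_subset hv fun _ hu => hu.2

theorem notMem_nbrs_self (v : ℤ × ℤ) : v ∉ nbrs v := lattice.loopless.irrefl v

theorem waveStart_apply (h3 : ∀ w ∈ T, φ w = 3) (v w : ℤ × ℤ) : waveStart φ T v w =
    φ w + lap (1, 0) (0, 1) (Set.indicator (waveFront T v) 1) w := by
  classical
  have unstable : ((nbrs v).filter fun u => u ∈ T ∧ 4 ≤ topple v (φ + Pi.single v 1) u) =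
      (nbrs v).filter (· ∈ T) := by
    refine Finset.filter_congr fun u hu => and_iff_left_of_imp fun huT => ?_
    have hne : u ≠ v := fun h => notMem_nbrs_self v (h ▸ hu)
    rw [topple_apply, lap_single, if_neg hne,
      if_pos (show v ∈ nbrs u from lattice.symm.symm _ _ hu), Pi.add_apply,
      Pi.single_eq_of_ne hne, h3 u huT]
    norm_num
  have front : waveFront T v = ↑(insert v ((nbrs v).filter (· ∈ T))) := by
    ext u
    simp only [waveFront, Finset.coe_insert, Finset.coe_filter]
  have hv : v ∉ (nbrs v).filter (· ∈ T) := fun h =>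
    notMem_nbrs_self v (Finset.mem_filter.1 h).1
  simp only [waveStart, unstable, front, lap_indicator, Finset.sum_insert hv]
  simp only [Pi.add_apply, Pi.sub_apply, Finset.sum_apply, topple_apply, add_sub_cancel_left]
  ring

namespace IsTerritory

theorem exists_step (hT : IsTerritory φ T) (hv : v ∈ T) : ∃ w ∈ T, Step (1, 0) (0, 1) v w := by
  obtain ⟨b, hb, hne⟩ := hT.nontrivial.exists_ne v
  obtain rfl | ⟨w, hw, -⟩ := Relation.ReflTransGen.cases_head (hT.pathIn hv hb)
  · exact absurd rfl hne
  · exact ⟨w, hw.2, hw.1⟩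

theorem exists_step_waveFront (hT : IsTerritory φ T) (hv : v ∈ T) (hw : w ∈ waveFront T v) :
    ∃ u ∈ waveFront T v, Step (1, 0) (0, 1) w u := by
  rcases hw with rfl | hw
  · obtain ⟨u, huT, hu⟩ := hT.exists_step hv
    exact ⟨u, .inr ⟨mem_nbrs_iff_step.2 hu, huT⟩, hu⟩
  · exact ⟨v, .inl rfl, (mem_nbrs_iff_step.1 hw.1).symm⟩

theorem isState_waveStart (hT : IsTerritory φ T) (hφ : IsState φ) (hv : v ∈ T) :
    IsState (waveStart φ T v) := by
  have hI : ∀ x, (0 : ℤ) ≤ Set.indicator (waveFront T v) 1 x :=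
    Set.indicator_nonneg fun _ _ => zero_le_one
  intro x
  rw [waveStart_apply hT.eq_three]
  by_cases hx : x ∈ waveFront T v
  · obtain ⟨u, hu, hxu⟩ := hT.exists_step_waveFront hv hx
    have hle := le_lap_add hI hxu
    rw [Set.indicator_of_mem hu, Set.indicator_of_mem hx, Pi.one_apply, Pi.one_apply] at hle
    have := hT.eq_three x (waveFront_subset hv hx)
    omega
  · have hle := le_lap_add hI (.inl rfl : Step (1, 0) (0, 1) x (x + (1, 0)))
    rw [Set.indicator_of_notMem hx, mul_zero, add_zero] at hle
    exact add_nonneg (hφ x) ((hI _).trans hle)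

theorem pos_of_stable (hT : IsTerritory φ T) {J : ℤ × ℤ → ℤ} (hJ₀ : ∀ x, 0 ≤ J x)
    (hJ : ∀ x, φ x + lap (1, 0) (0, 1) J x < 4) (hv : v ∈ T) (hJv : 0 < J v) (hw : w ∈ T) :
    0 < J w :=
  (hT.pathIn hv hw).mem_of_closed (Y := {x | 0 < J x}) hJv fun y hy z hz hyz => by
    -- A neighbour in `T` of a toppled vertex is unstable until it topples itself.
    have hle := le_lap_add hJ₀ hyz.symm
    have hJy : 0 < J y := hy
    have := hJ z
    have := hT.eq_three z hz
    change 0 < J z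
    omega

theorem exists_wave (hT : IsTerritory φ T) (hφ : IsState φ) (hv : v ∈ T) {H : ℤ × ℤ → ℤ}
    (hH₀ : ∀ x, 0 ≤ H x) (hHT : ∀ x ∈ T, H x = 1)
    (hH : ∀ x, φ x + lap (1, 0) (0, 1) H x < 4) :
    ∃ J : ℤ × ℤ → ℤ, (∀ x, 0 ≤ J x) ∧ (∀ x, J x ≤ H x) ∧ (∀ x ∈ T, J x = 1) ∧
      RelaxesTo (waveStart φ T v) fun x => φ x + lap (1, 0) (0, 1) J x := by
  set I : ℤ × ℤ → ℤ := Set.indicator (waveFront T v) 1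
  have hI₀ : ∀ x, 0 ≤ I x := Set.indicator_nonneg fun _ _ => zero_le_one
  have hIH : ∀ x, I x ≤ H x := Set.indicator_le'
    (fun x hx => (hHT x (waveFront_subset hv hx)).ge) fun x _ => hH₀ x
  have hIv : I v = 1 := Set.indicator_of_mem (Set.mem_insert v _) 1
  obtain ⟨u, hu₀, huH, hu⟩ := exists_relaxation (hT.isState_waveStart hφ hv)
    (H := fun x => H x - I x) (fun x => sub_nonneg.2 (hIH x)) fun x => by
      rw [waveStart_apply hT.eq_three, lap_sub, add_add_sub_cancel]
      exact hH x
  have hresult : ∀ x, waveStart φ T v x + lap (1, 0) (0, 1) u x =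
      φ x + lap (1, 0) (0, 1) (fun x => I x + u x) x := fun x => by
    rw [waveStart_apply hT.eq_three, lap_add, add_assoc]
  simp only [hresult] at hu
  have hJ₀ : ∀ x, 0 ≤ I x + u x := fun x => add_nonneg (hI₀ x) (hu₀ x)
  have hJH : ∀ x, I x + u x ≤ H x := fun x => le_sub_iff_add_le'.1 (huH x)
  have hJv : 0 < I v + u v := by
    rw [hIv]
    exact add_pos_of_pos_of_nonneg one_pos (hu₀ v)
  exact ⟨_, hJ₀, hJH, fun x hx => ((hJH x).trans_eq (hHT x hx)).antisymm
    (hT.pos_of_stable hJ₀ hu.2.1.2 hv hJv hx), hu⟩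

end IsTerritory

end Wave

section ShiftOdometer

variable {p q : ℤ} {θ : ℤ → ℤ} {v w : ℤ × ℤ}

theorem exists_level_minimum (hpq : IsCoprime p q) {u : ℤ × ℤ → ℤ} (hu : ∀ v, 0 ≤ u v) :
    ∃ m : ℤ → ℤ, (∀ v, m (form p q v) ≤ u v) ∧ ∀ k, ∃ v, form p q v = k ∧ u v = m k := by
  have attained : ∀ k, ∃ c, (∃ v, form p q v = k ∧ u v = c) ∧
      ∀ d, (∃ v, form p q v = k ∧ u v = d) → c ≤ d := fun k => by
    obtain ⟨v, hv⟩ := exists_form_eq hpq k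
    exact Int.exists_least_of_bdd ⟨0, fun _ ⟨w, _, hw⟩ => hw ▸ hu w⟩ ⟨u v, v, hv, rfl⟩
  choose m hm hmin using attained
  exact ⟨m, fun v => hmin _ _ ⟨v, rfl, rfl⟩, hm⟩

namespace IsProfile

/-- The minima of `u` over the levels turn a stabilizing toppling function into a superharmonic
function of the level, to which the minimality of the profile applies. -/
theorem shiftOdometer_le (hθ : IsProfile p q θ) (hpq : IsCoprime p q) {u : ℤ × ℤ → ℤ} {R n : ℤ}
    (hu₀ : ∀ v, 0 ≤ u v) (hR : ∀ v, R < form p q v → n ≤ u v)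
    (hu : ∀ v, levelState p q θ v + lap (1, 0) (0, 1) u v ≤ 3) (v : ℤ × ℤ) :
    shiftOdometer p q θ n v ≤ u v := by
  obtain ⟨m, hmu, hm⟩ := exists_level_minimum hpq hu₀
  obtain ⟨R₀, hR₀⟩ := hθ.isStep.exists_eq_zero
  obtain ⟨R₁, hR₁⟩ := hθ.isStep.exists_eq_self
  have superharmonic : Superharmonic p q fun k => θ k + m k := fun k => by
    obtain ⟨v, rfl, hv⟩ := hm k
    have hlap := lap_le_lap_of_step (a := (1, 0)) (b := (0, 1)) (u := fun x => m (form p q x))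
      hv.symm fun y _ => hmu y
    rw [lap_form] at hlap
    have := hu v
    rw [levelState] at this
    rw [lap_add]
    omega
  have eventually_le : ∀ᶠ k in Filter.cofinite, min n k ≤ θ k + m k :=
    eventually_cofinite_of_le_abs (R := |R| + |R₀| + |R₁| + 1) fun k hk => by
      obtain ⟨v, rfl, hv⟩ := hm k
      have := hu₀ v
      have := le_abs_self R
      have := le_abs_self R₀
      have := neg_abs_le R₁
      have := abs_nonneg R
      have := abs_nonneg R₀
      have := abs_nonneg R₁
      rcases le_abs.1 hk with hk | hk
      · have := hR v (by omega)
        rw [hR₀ _ (by omega)]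
        omega
      · rw [hR₁ _ (by omega)]
        omega
  have hle := hθ.le_shift superharmonic n eventually_le (form p q v)
  have := hmu v
  rw [shiftOdometer]
  omega

theorem shiftOdometer_one_eq_one (hθ : IsProfile p q θ)
    (hv : v ∈ upperTerritory p q (levelState p q θ)) : shiftOdometer p q θ 1 v = 1 := by
  have := hθ.eq_of_notMem_risingLevels (hθ.form_notMem_risingLevels hv)
  rw [shiftOdometer, ← sub_eq_add_neg, ← this, add_sub_cancel_left]

theorem waveEq_upperTerritory (hθ : IsProfile p q θ) (hpq : IsCoprime p q)
    (hw : form p q w = 1) :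
    WaveEq (levelState p q θ) (upperTerritory p q (levelState p q θ))
      (fun v => levelState p q θ (v - w)) := by
  have hT := hθ.isTerritory_upperTerritory hpq
  refine ⟨hT, fun v hv => ⟨hθ.relaxable_add_single hpq hv, ?_⟩⟩
  have hshift : ∀ x, levelState p q θ x + lap (1, 0) (0, 1) (shiftOdometer p q θ 1) x =
      levelState p q θ (x - w) := fun x => by
    rw [levelState_add_lap_shiftOdometer, levelState, sub_eq_add_neg x, form_add, form_neg, hw]
  obtain ⟨J, hJ₀, hJle, hJT, hJ⟩ := hT.exists_wave hθ.isStable_levelState.1 hv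
    (hθ.shiftOdometer_nonneg zero_le_one) (fun _ => hθ.shiftOdometer_one_eq_one)
    fun x => (hshift x).trans_lt (hθ.isStable_levelState.2 _)
  obtain ⟨R, hR⟩ := hθ.exists_levelState_eq_three_of_lt_form
  obtain rfl : J = shiftOdometer p q θ 1 := funext fun x => (hJle x).antisymm <|
    hθ.shiftOdometer_le hpq hJ₀ (fun y hy => (hJT y (mem_upperTerritory_of_lt hpq hR hy)).ge)
      (fun y => Int.le_of_lt_add_one (hJ.2.1.2 y)) x
  simpa only [hshift] using hJ

end IsProfile

end ShiftOdometer

/-! ### Solitons -/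

section Soliton

variable {p q : ℤ} {θ : ℤ → ℤ} {T : Set (ℤ × ℤ)} {v : ℤ × ℤ}

namespace IsTerritory

theorem exists_mem_form_lt (hT : IsTerritory (levelState p q θ) T) (hpq : IsCoprime p q)
    (hv : v ∈ T) (hzero : ∀ s, form p q v ≤ s → θ s = 0) :
    ∃ w ∈ T, form p q v < form p q w := by
  obtain ⟨e, he, he_pos, hmax⟩ := exists_steepest hpq
  have hlt : form p q v < form p q (e + v) := by
    rw [form_add]
    exact lt_add_of_pos_left _ he_pos
  have hstep : Step (1, 0) (0, 1) v (e + v) := by simpa only [zero_add] using he.add_right v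
  refine ⟨e + v, hT.mem_of_step hv hstep (levelState_eq_three_iff.2 ?_), hlt⟩
  rw [← lap_form]
  refine lap_eq_zero_of_step fun y hy => ?_
  have hle := hmax _ _ hy.symm
  rw [form_add, add_comm, add_le_add_iff_right] at hle
  rw [hzero _ hle, hzero _ hlt.le]

theorem isHarmonicBarrier_image_form (hT : IsTerritory (levelState p q θ) T)
    (hpq : IsCoprime p q) (hinf : T.Infinite) (hfin : (form p q '' T).Finite) :
    IsHarmonicBarrier p q θ (form p q '' T) := by
  obtain ⟨a, ha, b, hb, hne, hf⟩ :=
    hinf.exists_ne_map_eq_of_mapsTo (Set.mapsTo_image (form p q) T) hfin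
  refine ⟨isBarrier_image_form hpq hfin ha (hT.pathIn ha hb) hne hf, ?_, ?_⟩
  · rintro _ ⟨x, hx, rfl⟩ _ ⟨y, hy, rfl⟩
    exact (hT.pathIn hx hy).map (fun _ _ => step_form p q) (Set.mapsTo_image _ T)
  · rintro _ ⟨x, hx, rfl⟩
    exact levelState_eq_three_iff.1 (hT.eq_three x hx)

end IsTerritory

namespace IsProfile

theorem infinite_image_form (hθ : IsProfile p q θ) (hpq : IsCoprime p q)
    (hT : IsTerritory (levelState p q θ) T) (hinf : T.Infinite) : (form p q '' T).Infinite := by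
  intro hfin
  rcases (hT.isHarmonicBarrier_image_form hpq hinf hfin).eq_self_or_eq_zero hθ with hself | hzero
  · obtain ⟨_, ⟨v, hv, rfl⟩, hmin⟩ := Set.exists_min_image _ id hfin (hinf.nonempty.image _)
    have hzero : ∀ s, form (-p) (-q) v ≤ s → θ s = 0 := fun s hs => by
      rw [form_neg_neg, neg_le] at hs
      have := hself (-s) fun b hb => hs.trans (hmin b hb)
      rw [hθ.reflect] at this
      omega
    have hT' : IsTerritory (levelState (-p) (-q) θ) T := hθ.levelState_neg_neg ▸ hT
    obtain ⟨w, hw, hlt⟩ := hT'.exists_mem_form_lt hpq.neg_neg hv hzero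
    rw [form_neg_neg, form_neg_neg, neg_lt_neg_iff] at hlt
    exact hlt.not_ge (hmin _ ⟨w, hw, rfl⟩)
  · obtain ⟨_, ⟨v, hv, rfl⟩, hmax⟩ := Set.exists_max_image _ id hfin (hinf.nonempty.image _)
    obtain ⟨w, hw, hlt⟩ := hT.exists_mem_form_lt hpq hv fun s hs =>
      hzero s fun b hb => (hmax b hb).trans hs
    exact hlt.not_ge (hmax _ ⟨w, hw, rfl⟩)

theorem eq_upperTerritory_or_eq_neg (hθ : IsProfile p q θ) (hpq : IsCoprime p q)
    (hT : IsTerritory (levelState p q θ) T) (hinf : T.Infinite) :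
    T = upperTerritory p q (levelState p q θ) ∨ T = -upperTerritory p q (levelState p q θ) := by
  obtain ⟨R, hR⟩ := hθ.exists_levelState_eq_three
  obtain ⟨v, hv, hvR⟩ : ∃ v ∈ T, R < |form p q v| := by
    by_contra! hle
    refine hθ.infinite_image_form hpq hT hinf ((Set.finite_Icc (-R) R).subset ?_)
    rintro _ ⟨v, hv, rfl⟩
    exact abs_le.1 (hle v hv)
  rw [neg_upperTerritory hθ.levelState_neg]
  refine (lt_abs.1 hvR).imp (fun h => ?_) fun h => ?_
  · exact hT.eq_upperTerritory hpq hθ.levelState_le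
      (fun w hw => hR w (hw.trans_le (le_abs_self _))) hv h
  · refine hT.eq_upperTerritory hpq.neg_neg hθ.levelState_le
      (fun w hw => hR w (hw.trans_le ?_)) hv (by rwa [form_neg_neg])
    rw [form_neg_neg]
    exact neg_le_abs _

theorem exists_two_territories (hθ : IsProfile p q θ) (hpq : IsCoprime p q) :
    ∃ T : Set (ℤ × ℤ), IsTerritory (levelState p q θ) T ∧ T.Infinite ∧
      IsTerritory (levelState p q θ) (-T) ∧
      (∀ T', IsTerritory (levelState p q θ) T' → T'.Infinite → T' = T ∨ T' = -T) ∧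
      (∀ v ∈ T, 0 < form p q v) ∧ (∀ v ∈ -T, form p q v < 0) ∧
      ∀ p' q', form p q (p', q') = 1 →
        WaveEq (levelState p q θ) T (fun v => levelState p q θ (v - (p', q'))) ∧
          WaveEq (levelState p q θ) (-T) (fun v => levelState p q θ (v + (p', q'))) := by
  have hneg := neg_upperTerritory (p := p) (q := q) hθ.levelState_neg
  obtain ⟨R, hR⟩ := hθ.exists_levelState_eq_three_of_lt_form
  refine ⟨upperTerritory p q (levelState p q θ), hθ.isTerritory_upperTerritory hpq,
    infinite_upperTerritory hpq hR, ?_, fun T' => hθ.eq_upperTerritory_or_eq_neg hpq,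
    fun v => hθ.form_pos_of_mem hpq, fun v hv => ?_, fun p' q' hw =>
    ⟨hθ.waveEq_upperTerritory hpq hw, ?_⟩⟩
  · simpa only [hθ.levelState_neg_neg, ← hneg] using
      hθ.neg.isTerritory_upperTerritory hpq.neg_neg
  · simpa only [form_neg, neg_pos] using hθ.form_pos_of_mem hpq (Set.mem_neg.1 hv)
  · simpa only [hθ.levelState_neg_neg, ← hneg, sub_neg_eq_add] using
      hθ.neg.waveEq_upperTerritory hpq.neg_neg (w := -(p', q'))
        (by rw [form_neg_neg, form_neg, hw, neg_neg])

end IsProfile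

end Soliton

section Direction

variable {α : Projectivization ℚ (ℚ × ℚ)} {p q a b : ℤ}

theorem eq_or_eq_neg_of_mul_eq_mul (hpq : IsCoprime p q) (hab : IsCoprime a b)
    (h : a * q = b * p) : (a = p ∧ b = q) ∨ (a = -p ∧ b = -q) := by
  obtain ⟨x, y, hxy⟩ := hpq
  obtain ⟨x', y', hxy'⟩ := hab
  have ha : a = (x * a + y * b) * p := by linear_combination -a * hxy + y * h
  have hb : b = (x * a + y * b) * q := by linear_combination -b * hxy - x * h
  have hunit : IsUnit (x * a + y * b) :=
    .of_mul_eq_one (x' * p + y' * q) (by linear_combination hxy' - x' * ha - y' * hb)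
  refine (Int.isUnit_iff.1 hunit).imp (fun hc => ?_) fun hc => ?_ <;> rw [hc] at ha hb <;> omega

theorem IsPrimitiveVector.eq_or_eq_neg (h : IsPrimitiveVector α p q)
    (h' : IsPrimitiveVector α a b) : (a = p ∧ b = q) ∨ (a = -p ∧ b = -q) := by
  refine eq_or_eq_neg_of_mul_eq_mul h.1 h'.1 ?_
  have hline := h.2
  have hline' := h'.2
  rw [Projectivization.submodule_eq, Submodule.mem_span_singleton] at hline hline'
  obtain ⟨s, hs⟩ := hline
  obtain ⟨t, ht⟩ := hline'
  have hp : s * α.rep.1 = p := congrArg Prod.fst hs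
  have hq : s * α.rep.2 = q := congrArg Prod.snd hs
  have ha : t * α.rep.1 = a := congrArg Prod.fst ht
  have hb : t * α.rep.2 = b := congrArg Prod.snd ht
  have : (a : ℚ) * q = b * p := by
    rw [← hp, ← hq, ← ha, ← hb]
    ring
  exact_mod_cast this

theorem toPlane_eq_smul_add_smul (h : a * p + b * q = 1) (v : ℤ × ℤ) :
    toPlane v = ((a * v.1 + b * v.2 : ℤ) : ℝ) • toPlane (p, q) +
      (form p q v : ℝ) • toPlane (b, -a) := by
  have hfst : v.1 = (a * v.1 + b * v.2) * p + form p q v * b := by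
    simp only [form]
    linear_combination -v.1 * h
  have hsnd : v.2 = (a * v.1 + b * v.2) * q + form p q v * -a := by
    simp only [form]
    linear_combination -v.2 * h
  ext i
  fin_cases i
  · simpa [toPlane] using congrArg (Int.cast : ℤ → ℝ) hfst
  · simpa [toPlane] using congrArg (Int.cast : ℤ → ℝ) hsnd

theorem exists_toPlane_mem_thickening (hpq : IsCoprime p q) (R : ℤ) :
    ∃ r : ℝ, ∀ v, |form p q v| ≤ R → toPlane v ∈ Metric.thickening r (line p q) := by
  obtain ⟨a, b, hab⟩ := hpq
  refine ⟨R * ‖toPlane (b, -a)‖ + 1, fun v hv => Metric.mem_thickening_iff.2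
    ⟨_, Submodule.smul_mem _ ((a * v.1 + b * v.2 : ℤ) : ℝ) (Submodule.mem_span_singleton_self _),
      ?_⟩⟩
  have hR : |(form p q v : ℝ)| ≤ R := by exact_mod_cast hv
  rw [dist_eq_norm, toPlane_eq_smul_add_smul hab v, add_sub_cancel_left, norm_smul,
    Real.norm_eq_abs]
  exact (mul_le_mul_of_nonneg_right hR (norm_nonneg _)).trans_lt (lt_add_one _)

end Direction

theorem IsProfile.isSandSoliton {α : Projectivization ℚ (ℚ × ℚ)} {p q : ℤ} {θ : ℤ → ℤ}
    (hθ : IsProfile p q θ) (hα : IsPrimitiveVector α p q) :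
    IsSandSoliton α (levelState p q θ) := by
  have primitive : ∀ a b, IsPrimitiveVector α a b →
      IsProfile a b θ ∧ levelState p q θ = levelState a b θ := fun a b hab => by
    rcases hα.eq_or_eq_neg hab with ⟨rfl, rfl⟩ | ⟨rfl, rfl⟩
    · exact ⟨hθ, rfl⟩
    · exact ⟨hθ.neg, hθ.levelState_neg_neg.symm⟩
  refine ⟨hθ.isStable_levelState, hθ.levelState_neg, fun a b hab v => ?_, fun a b hab => ?_,
    fun a b hab => ?_⟩ <;> obtain ⟨hprofile, heq⟩ := primitive a b hab <;> rw [heq]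
  · have hdir : form a b (a, b) = 0 := by
      simp only [form]
      ring
    rw [levelState, form_add, hdir, add_zero, levelState]
  · obtain ⟨R, hR⟩ := hprofile.exists_levelState_eq_three
    obtain ⟨r, hr⟩ := exists_toPlane_mem_thickening hab.1 R
    exact ⟨r, fun v hv => hr v (not_lt.1 fun h => hv.ne (hR v h))⟩
  · exact hprofile.exists_two_territories hab.1

end Sandpile

theorem mainTheorem7 (α : Projectivization ℚ (ℚ × ℚ)) :
    ∃ φ : ℤ × ℤ → ℤ, Sandpile.IsSandSoliton α φ := by
  obtain ⟨p, q, hα⟩ := Sandpile.exists_isPrimitiveVector α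
  obtain ⟨θ, hθ⟩ := Sandpile.exists_isProfile hα.1
  exact ⟨Sandpile.levelState p q θ, hθ.isSandSoliton hα⟩
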